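/- Let $p(w)=e^{-1/|w|}$ for $w\neq 0$, and let $\nu$ and $\pi$ be the Borel measures on $\mathbb R$ concentrated on $\{|w|\ge 1\}$ with densities $$\nu\{dz\}=\frac{e\,[1-p(z)]\,dz}{2z^{2}},\qquad \pi\{dw\}=\frac{dw}{2w^{2}}\qquad(|z|,|w|\ge 1).$$ Let $Q(w;B)=p(w)\mathbf 1_B(w)+[1-p(w)]\,\nu\{B\}$ for $w\in\mathbb R$ and Borel $B\subseteq\mathbb R$, and let $g(w)=\mathrm{sign}(w)$. Then $\nu$ and $\pi$ are probability measures, $Q$ is a stochastic transition function which is reversible with respect to $\pi$ (that is, $\int_A Q(w;B)\,\pi\{dw\}=\int_B Q(w;A)\,\pi\{dw\}$ for all Borel $A,B$), $g\in L^\infty(\pi)$, and $\int g\,d\pi=0$. There is a two-sided stationary Markov chain $\ldots,W_{-1},W_0,W_1,\ldots$ with transition function $Q$ and marginal distribution $\pi$. For every such chain, defined on a probability space $(\Omega,\mathcal A,P)$, put $S_n=g(W_1)+\cdots+g(W_n)$, $\sigma_n^2=E(S_n^2)$ with $\sigma_n\ge 0$, and $\ell(n)=\sigma_n^2/n$. Then,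 as $n\to\infty$: 1. $\sigma_n^2\sim 2n\log n$, so that $\ell(n)\sim 2\log n$, and $\ell$ is slowly varying, i.e. $\ell(n)>0$ for all large $n$ and $\ell(\lfloor cn\rfloor)/\ell(n)\to1$ for every $c>0$. 2. The conditional distribution of $S_n/\sigma_n$ given $W_0$ converges in probability (in the weak topology on probability measures on $\mathbb R$) to $\mathrm{Normal}[0,\tfrac12]$; also $S_n/\sigma_n\Rightarrow \mathrm{Normal}[0,\tfrac12]$ unconditionally. 3. $E|S_n|\sim \mathbf{\pi}^{-1/2}\sigma_n$, and $S_n/E|S_n|\Rightarrow\mathrm{Normal}[0,\tfrac12\mathbf{\pi}]$, where in this item $\mathbf{\pi}=3.14159\ldots$ is the number. Here $\mathrm{Normal}[0,v]$ is the normal distribution with mean $0$ and variance $v$. -/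

import Mathlib

open MeasureTheory ProbabilityTheory Filter Topology

namespace HoldingChain

/-- The holding probability `p(w) = e^{-1/|w|}`. (The value at `w = 0` is irrelevant: the measures
`nu` and `pi` below live on `{|w| ≥ 1}`.) -/
noncomputable def p (w : ℝ) : ℝ := Real.exp (-1 / |w|)

lemma measurable_p : Measurable p := by
  unfold p; fun_prop

/-- The jump law `ν(dz) = e (1 - p(z)) dz / (2 z²)` on `|z| ≥ 1`. -/
noncomputable def nu : Measure ℝ :=
  (volume.restrict {z : ℝ | 1 ≤ |z|}).withDensity
    fun z => ENNReal.ofReal (Real.exp 1 * (1 - p z) / (2 * z ^ 2))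

/-- The stationary law `π(dw) = dw / (2 w²)` on `|w| ≥ 1`. -/
noncomputable def pi : Measure ℝ :=
  (volume.restrict {w : ℝ | 1 ≤ |w|}).withDensity
    fun w => ENNReal.ofReal (1 / (2 * w ^ 2))

/-- The transition function `Q(w; B) = p(w) 1_B(w) + (1 - p(w)) ν(B)`. -/
noncomputable def Q : Kernel ℝ ℝ where
  toFun w := ENNReal.ofReal (p w) • Measure.dirac w + ENNReal.ofReal (1 - p w) • nu
  measurable' := by
    refine Measure.measurable_of_measurable_coe _ fun B hB => ?_
    simp only [Measure.coe_add, Measure.coe_smul, Pi.add_apply, Pi.smul_apply, smul_eq_mul,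
      Measure.dirac_apply' _ hB]
    exact ((measurable_p.ennreal_ofReal).mul (measurable_one.indicator hB)).add
      (((measurable_const.sub measurable_p).ennreal_ofReal).mul_const _)

/-- The observable `g = sign`. -/
noncomputable def g (w : ℝ) : ℝ := Real.sign w

/-- `W` is a two-sided stationary Markov chain on `(Ω, P)` with transition function `κ` and
marginal distribution `μ`: every `W n` has law `μ`, and given the whole past
`σ(W k : k ≤ n)`, the conditional law of `W (n + 1)` is `κ (W n)`. -/
structure IsStationaryMarkovChain {Ω : Type*} [MeasurableSpace Ω] (P : Measure Ω)
    (κ : Kernel ℝ ℝ) (μ : Measure ℝ) (W : ℤ → Ω → ℝ) : Prop where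
  measurable : ∀ n, Measurable (W n)
  marginal : ∀ n, P.map (W n) = μ
  markov : ∀ (n : ℤ) (B : Set ℝ), MeasurableSet B →
    P[(W (n + 1) ⁻¹' B).indicator (fun _ => (1 : ℝ)) |
        ⨆ (k : ℤ) (_ : k ≤ n), MeasurableSpace.comap (W k) inferInstance]
      =ᵐ[P] fun ω => (κ (W n ω)).real B

/-- The partial sum `S_n = g(W_1) + ⋯ + g(W_n)`. -/
noncomputable def S {Ω : Type*} (W : ℤ → Ω → ℝ) (n : ℕ) (ω : Ω) : ℝ :=
  ∑ k ∈ Finset.Icc 1 n, g (W (k : ℤ) ω)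

/-- `σ_n = (E S_n²)^{1/2}`. -/
noncomputable def sigma {Ω : Type*} [MeasurableSpace Ω] (P : Measure Ω) (W : ℤ → Ω → ℝ)
    (n : ℕ) : ℝ :=
  √(∫ ω, S W n ω ^ 2 ∂P)

/-- `ℓ(n) = σ_n² / n`, i.e. `σ_n² = n ℓ(n)`. -/
noncomputable def ell {Ω : Type*} [MeasurableSpace Ω] (P : Measure Ω) (W : ℤ → Ω → ℝ)
    (n : ℕ) : ℝ :=
  sigma P W n ^ 2 / n

/-- Slow variation (at infinity) of a sequence: it is eventually positive and
`L(⌊c n⌋) / L(n) → 1` for every `c > 0`. -/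
def IsSlowlyVarying (L : ℕ → ℝ) : Prop :=
  (∀ᶠ n in atTop, 0 < L n) ∧
    ∀ c : ℝ, 0 < c → Tendsto (fun n : ℕ => L ⌊c * n⌋₊ / L n) atTop (𝓝 1)

/-- The (regular) conditional distribution of `Z` given `Y`, as a random probability measure. -/
noncomputable def condLaw {Ω : Type*} [MeasurableSpace Ω] (P : Measure Ω) [IsProbabilityMeasure P]
    (Z Y : Ω → ℝ) (ω : Ω) : ProbabilityMeasure ℝ :=
  ⟨condDistrib Z Y P (Y ω), inferInstance⟩

/-- `Z_n | Y ⇒ᵖ G`: the conditional distribution of `Z_n` given `Y` converges to `G` in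
probability, for the topology of weak convergence of probability measures on `ℝ`. -/
def TendstoInCondDistribution {Ω : Type*} [MeasurableSpace Ω] (P : Measure Ω)
    [IsProbabilityMeasure P] (Z : ℕ → Ω → ℝ) (Y : Ω → ℝ) (G : ProbabilityMeasure ℝ) : Prop :=
  ∀ U ∈ 𝓝 G, Tendsto (fun n => P {ω | condLaw P (Z n) Y ω ∉ U}) atTop (𝓝 0)

end HoldingChain

namespace HoldingChain

/-! The chain stays at `w` for a geometric time governed by `p w`, then jumps to a fresh `nu`-point,
so `S_n` is a sum of signed runs. Odd functions have `nu`-mean zero, hence `Q` sends `p ^ m * g` to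
`p ^ (m + 1) * g`, and the lag-`k` covariance of `g` is `∫ p ^ k ∂pi = (1 - exp (-k)) / k`. Summing
gives an exact formula for `E S_n²` (`integral_S_sq`) and `σ_n² ~ 2 n log n`.

The limit law comes from the tilted operator `f ↦ Q (exp (i a g) f)`. With `b = exp (δ + i a g)`,
the function `ψ = (1 - p) / (1 - p b)` satisfies the eigenvalue equation for `exp (-δ)` up to the
error `exp (-δ) (1 - p) D`, where `D = ∫ (b - 1) / (1 - p b) ∂nu` (`integral_tilted_Q`). The
integral `D` is elementary and contains `(b - 1)² log (1 - b)`. If `a_n² n log n → 2 s` and `δ = s /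
n`, then `n D → 0` (`tendsto_nat_mul_defect`): the linear terms contribute `2 s`, and each sign of
`g` takes away `s` because `log |1 - b| ~ -(1/2) log n`. That factor 1/2 is why the limiting
variance is only half of the limit of the normalized second moments. After `n` iterations `E_w[exp
(i a S_n) ψ(W_n)]` tends to `exp (-s)`. As `ψ → 1` boundedly and the law of `W_n` is at most `δ_w +
e pi`, the factor `ψ` can be dropped (`tendsto_integral_exp_sumState`).

Taking `a_n = t / σ_n` gives `s = t² / 4`, the Gaussian limit from every nonzero starting point; the
conditional and unconditional statements follow. Since `S_n / σ_n` has second moment 1, first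
absolute moments converge as well, which gives the asymptotics of `E|S_n|` and the last limit law.

A chain exists because a reversible kernel can be run from a stationary point in both time
directions with independent noises; reversibility makes the resulting law shift invariant
(`twoSidedLaw_map_shift_one`). -/

lemma p_pos (w : ℝ) : 0 < p w := Real.exp_pos _

lemma p_le_one (w : ℝ) : p w ≤ 1 := by
  unfold p
  rw [Real.exp_le_one_iff, neg_div]
  have : 0 ≤ 1 / |w| := by positivity
  linarith

lemma p_lt_one {w : ℝ} (hw : w ≠ 0) : p w < 1 := by
  unfold p
  rw [Real.exp_lt_one_iff, neg_div]
  have : 0 < 1 / |w| := by positivity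
  linarith

lemma p_neg (w : ℝ) : p (-w) = p w := by simp [p]

lemma p_of_pos {w : ℝ} (hw : 0 < w) : p w = Real.exp (-1 / w) := by
  rw [p, abs_of_pos hw]

lemma measurable_g : Measurable g := by
  unfold g Real.sign
  exact Measurable.ite measurableSet_Iio measurable_const
    (Measurable.ite measurableSet_Ioi measurable_const measurable_const)

lemma g_neg (w : ℝ) : g (-w) = -g w := by simp [g, Real.sign_neg]

lemma g_of_pos {w : ℝ} (hw : 0 < w) : g w = 1 := Real.sign_of_pos hw

lemma abs_g_le_one (w : ℝ) : |g w| ≤ 1 := by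
  rcases Real.sign_apply_eq w with h | h | h <;> simp [g, h]

lemma g_sq {w : ℝ} (hw : w ≠ 0) : g w ^ 2 = 1 := by
  rcases Real.sign_apply_eq_of_ne_zero w hw with h | h <;> simp [g, h]

/-! ### Reduction of `pi` to a half line, and the moments of `p` -/

/-- The density of `pi` on the half line `(1, ∞)`. -/
noncomputable def halfPi : Measure ℝ :=
  (volume.restrict (Set.Ioi 1)).withDensity fun w => ENNReal.ofReal (1 / (2 * w ^ 2))

lemma measurable_density : Measurable fun w : ℝ => ENNReal.ofReal (1 / (2 * w ^ 2)) := by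
  fun_prop

lemma lintegral_halfPi {f : ℝ → ENNReal} (hf : Measurable f) :
    ∫⁻ w, f w ∂halfPi = ∫⁻ w in Set.Ioi 1, ENNReal.ofReal (1 / (2 * w ^ 2)) * f w := by
  rw [halfPi, lintegral_withDensity_eq_lintegral_mul _ measurable_density hf]
  rfl

lemma integral_halfPi {E : Type*} [NormedAddCommGroup E] [NormedSpace ℝ E] (f : ℝ → E) :
    ∫ w, f w ∂halfPi = ∫ w in Set.Ioi 1, (1 / (2 * w ^ 2)) • f w := by
  rw [halfPi, integral_withDensity_eq_integral_toReal_smul measurable_density (by simp)]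
  refine integral_congr_ae (ae_of_all _ fun w => ?_)
  simp only
  rw [ENNReal.toReal_ofReal (by positivity)]

/-- Reflection symmetry reduces every `pi`-integral to `(1, ∞)`, where `|w| = w` and primitives are
explicit; the endpoints `±1` are null. -/
lemma pi_eq_halfPi_add : pi = halfPi + halfPi.map (fun w => -w) := by
  refine Measure.ext_of_lintegral _ fun f hf => ?_
  rw [lintegral_add_measure, lintegral_map hf measurable_neg, lintegral_halfPi hf,
    lintegral_halfPi (f := fun w => f (-w)) (by fun_prop), pi,
    lintegral_withDensity_eq_lintegral_mul _ measurable_density hf]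
  have hset : {w : ℝ | 1 ≤ |w|} = Set.Ici 1 ∪ Set.Iic (-1) := by
    ext w
    simp only [Set.mem_ofPred_eq, Set.mem_union, Set.mem_Ici, Set.mem_Iic, le_abs]
    constructor <;> rintro (h | h) <;> [left; right; left; right] <;> linarith
  have hdisj : Disjoint (Set.Ici (1 : ℝ)) (Set.Iic (-1)) :=
    Set.disjoint_left.2 fun x hx hx' => by
      simp only [Set.mem_Ici, Set.mem_Iic] at hx hx'; linarith
  rw [hset, lintegral_union measurableSet_Iic hdisj]
  congr 1
  · exact setLIntegral_congr Ioi_ae_eq_Ici.symm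
  · have hmp := Measure.measurePreserving_neg (volume : Measure ℝ)
    refine (hmp.setLIntegral_comp_preimage measurableSet_Iic
      (f := fun w => ENNReal.ofReal (1 / (2 * w ^ 2)) * f w) (measurable_density.mul hf)).symm.trans ?_
    have : (Neg.neg ⁻¹' Set.Iic (-1 : ℝ)) = Set.Ici 1 := by
      ext x; simp
    rw [this, setLIntegral_congr Ioi_ae_eq_Ici.symm]
    simp

lemma hasDerivAt_exp_neg_div (k : ℝ) {w : ℝ} (hw : w ≠ 0) :
    HasDerivAt (fun x : ℝ => Real.exp (-k / x)) (Real.exp (-k / w) * (k / w ^ 2)) w := by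
  have h := ((hasDerivAt_inv hw).const_mul (-k)).exp
  convert h using 1 <;> simp [div_eq_mul_inv]

lemma tendsto_const_div_atTop (k : ℝ) : Tendsto (fun x : ℝ => k / x) atTop (𝓝 0) :=
  tendsto_const_nhds.div_atTop tendsto_id

lemma lintegral_p_pow_halfPi {k : ℕ} (hk : k ≠ 0) :
    ∫⁻ w, ENNReal.ofReal (p w ^ k) ∂halfPi =
      ENNReal.ofReal ((1 - Real.exp (-k)) / (2 * k)) := by
  have hk0 : (k : ℝ) ≠ 0 := by exact_mod_cast hk
  have hk1 : (0 : ℝ) < k := by positivity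
  rw [lintegral_halfPi ((measurable_p.pow_const k).ennreal_ofReal)]
  have hpow : ∀ w : ℝ, 0 < w → p w ^ k = Real.exp (-k / w) := fun w hw => by
    rw [p_of_pos hw, ← Real.exp_nat_mul]; congr 1; ring
  -- On the half line `p ^ k = exp (-k / x)`, and the density `1 / (2 x²)` is half the derivative of
  -- `-1 / x`.
  have hderiv : ∀ x ∈ Set.Ici (1 : ℝ), HasDerivAt (fun x : ℝ => Real.exp (-k / x) / (2 * k))
      (1 / (2 * x ^ 2) * p x ^ k) x := fun x hx => by
    have hx0 : x ≠ 0 := (lt_of_lt_of_le one_pos hx).ne'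
    refine ((hasDerivAt_exp_neg_div k hx0).div_const (2 * (k : ℝ))).congr_deriv ?_
    rw [hpow x (lt_of_lt_of_le one_pos hx)]; field_simp
  have hlim : Tendsto (fun x : ℝ => Real.exp (-k / x) / (2 * k)) atTop (𝓝 (1 / (2 * k))) := by
    simpa using ((Real.continuous_exp.tendsto 0).comp
      (tendsto_const_div_atTop (-(k : ℝ)))).div_const (2 * (k : ℝ))
  have hpos : ∀ x ∈ Set.Ioi (1 : ℝ), 0 ≤ 1 / (2 * x ^ 2) * p x ^ k := fun x _ => by
    have := p_pos x; positivity
  have hint := integrableOn_Ioi_deriv_of_nonneg' hderiv hpos hlim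
  have hval := integral_Ioi_of_hasDerivAt_of_nonneg' hderiv hpos hlim
  rw [show (1 - Real.exp (-k)) / (2 * (k : ℝ)) = ∫ x in Set.Ioi 1, 1 / (2 * x ^ 2) * p x ^ k by
    rw [hval]; simp; ring,
    ofReal_integral_eq_lintegral_ofReal hint
      ((ae_restrict_iff' measurableSet_Ioi).2 (ae_of_all _ hpos))]
  refine lintegral_congr fun w => ?_
  rw [ENNReal.ofReal_mul (by positivity)]

lemma halfPi_univ : halfPi Set.univ = ENNReal.ofReal (1 / 2) := by
  rw [← lintegral_one, lintegral_halfPi measurable_const]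
  have hderiv : ∀ x ∈ Set.Ici (1 : ℝ), HasDerivAt (fun x : ℝ => -1 / (2 * x))
      (1 / (2 * x ^ 2)) x := fun x hx => by
    have hx0 : x ≠ 0 := (lt_of_lt_of_le one_pos hx).ne'
    have h := (hasDerivAt_inv hx0).const_mul (-1 / 2 : ℝ)
    have hfun : (fun x : ℝ => -1 / (2 * x)) = fun y => -1 / 2 * y⁻¹ := by
      ext y; rw [← div_div, div_eq_mul_inv]
    rw [hfun]
    exact h.congr_deriv (by field_simp)
  have hlim : Tendsto (fun x : ℝ => -1 / (2 * x)) atTop (𝓝 0) :=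
    tendsto_const_nhds.div_atTop (tendsto_id.const_mul_atTop two_pos)
  have hpos : ∀ x ∈ Set.Ioi (1 : ℝ), 0 ≤ 1 / (2 * x ^ 2) := fun x _ => by positivity
  have hint := integrableOn_Ioi_deriv_of_nonneg' hderiv hpos hlim
  have hval := integral_Ioi_of_hasDerivAt_of_nonneg' hderiv hpos hlim
  rw [show (1 / 2 : ℝ) = ∫ x in Set.Ioi 1, 1 / (2 * x ^ 2) by rw [hval]; norm_num,
    ofReal_integral_eq_lintegral_ofReal hint
      ((ae_restrict_iff' measurableSet_Ioi).2 (ae_of_all _ hpos))]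
  simp

instance : IsFiniteMeasure halfPi := ⟨by simp [halfPi_univ]⟩

instance isProbabilityMeasure_pi : IsProbabilityMeasure pi := ⟨by
  rw [pi_eq_halfPi_add, Measure.add_apply, Measure.map_apply measurable_neg .univ,
    Set.preimage_univ, halfPi_univ, ← ENNReal.ofReal_add (by norm_num) (by norm_num)]
  norm_num⟩

lemma ae_ne_zero_pi : ∀ᵐ w ∂pi, w ≠ 0 := by
  refine (withDensity_absolutelyContinuous _ _).ae_le ?_
  have hm : MeasurableSet {w : ℝ | 1 ≤ |w|} := measurableSet_le measurable_const (by fun_prop)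
  filter_upwards [ae_restrict_mem hm] with w hw h0
  rw [h0] at hw
  simp at hw
  linarith

lemma pi_map_neg : pi.map (fun w => -w) = pi := by
  rw [pi_eq_halfPi_add, Measure.map_add _ _ measurable_neg, Measure.map_map measurable_neg
    measurable_neg, add_comm]
  congr 1
  convert Measure.map_id
  simp

lemma integral_pi_eq {E : Type*} [NormedAddCommGroup E] [NormedSpace ℝ E] {f : ℝ → E}
    (hf : Integrable f pi) :
    ∫ w, f w ∂pi = (∫ w, f w ∂halfPi) + ∫ w, f (-w) ∂halfPi := by
  rw [pi_eq_halfPi_add] at hf ⊢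
  rw [integrable_add_measure] at hf
  rw [integral_add_measure hf.1 hf.2, integral_map measurable_neg.aemeasurable hf.2.1]

lemma integral_pi_neg {E : Type*} [NormedAddCommGroup E] [NormedSpace ℝ E] (f : ℝ → E) :
    ∫ w, f (-w) ∂pi = ∫ w, f w ∂pi := by
  conv_rhs => rw [← pi_map_neg]
  exact (integral_map_equiv (MeasurableEquiv.neg ℝ) f).symm

lemma integrable_of_norm_le {α E : Type*} [MeasurableSpace α] [NormedAddCommGroup E]
    {μ : Measure α} [IsFiniteMeasure μ] {f : α → E} (hf : AEStronglyMeasurable f μ) {C : ℝ}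
    (h : ∀ x, ‖f x‖ ≤ C) : Integrable f μ :=
  Integrable.of_bound hf C (ae_of_all _ h)

lemma integrable_p_pow (k : ℕ) (μ : Measure ℝ) [IsFiniteMeasure μ] :
    Integrable (fun w => p w ^ k) μ :=
  integrable_of_norm_le (measurable_p.pow_const k).aestronglyMeasurable (C := 1) fun w => by
    rw [norm_pow, Real.norm_of_nonneg (p_pos w).le]
    exact pow_le_one₀ (p_pos w).le (p_le_one w)

/-- The decay of order `1 / k` is what produces the logarithm in the variance. -/
lemma integral_p_pow {k : ℕ} (hk : k ≠ 0) :
    ∫ w, p w ^ k ∂pi = (1 - Real.exp (-k)) / k := by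
  have hhalf : ∫ w, p w ^ k ∂halfPi = (1 - Real.exp (-k)) / (2 * k) := by
    rw [integral_eq_lintegral_of_nonneg_ae (ae_of_all _ fun w => pow_nonneg (p_pos w).le k)
      (measurable_p.pow_const k).aestronglyMeasurable, lintegral_p_pow_halfPi hk,
      ENNReal.toReal_ofReal]
    have : Real.exp (-k) ≤ 1 := Real.exp_le_one_iff.2 (by simp)
    exact div_nonneg (by linarith) (by positivity)
  rw [integral_pi_eq (integrable_p_pow k pi)]
  simp only [p_neg, hhalf]
  ring

/-! ### The jump law relative to the stationary law -/

lemma measurable_nuDensity : Measurable fun w => ENNReal.ofReal (Real.exp 1 * (1 - p w)) :=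
  ((measurable_const.sub measurable_p).const_mul _).ennreal_ofReal

lemma nuDensity_nonneg (w : ℝ) : 0 ≤ Real.exp 1 * (1 - p w) :=
  mul_nonneg (Real.exp_pos _).le (sub_nonneg.2 (p_le_one w))

/-- The jump law has density `e (1 - p)` with respect to the stationary law. -/
lemma nu_eq_withDensity : nu = pi.withDensity fun w => ENNReal.ofReal (Real.exp 1 * (1 - p w)) := by
  rw [nu, pi, ← withDensity_mul _ measurable_density measurable_nuDensity]
  congr 1
  ext w
  rw [Pi.mul_apply, ← ENNReal.ofReal_mul (by positivity)]
  congr 1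
  ring

lemma lintegral_nu {f : ℝ → ENNReal} (hf : Measurable f) :
    ∫⁻ w, f w ∂nu = ∫⁻ w, ENNReal.ofReal (Real.exp 1 * (1 - p w)) * f w ∂pi := by
  rw [nu_eq_withDensity, lintegral_withDensity_eq_lintegral_mul _ measurable_nuDensity hf]
  rfl

lemma integral_nu {E : Type*} [NormedAddCommGroup E] [NormedSpace ℝ E] (f : ℝ → E) :
    ∫ w, f w ∂nu = ∫ w, (Real.exp 1 * (1 - p w)) • f w ∂pi := by
  rw [nu_eq_withDensity, integral_withDensity_eq_integral_toReal_smul measurable_nuDensity (by simp)]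
  refine integral_congr_ae (ae_of_all _ fun w => ?_)
  simp only
  rw [ENNReal.toReal_ofReal (nuDensity_nonneg w)]

instance isProbabilityMeasure_nu : IsProbabilityMeasure nu := ⟨by
  -- The normalizing constant `e` comes from `∫ (1 - p) ∂pi = 1 - (1 - exp (-1)) = exp (-1)`.
  have h := integral_p_pow one_ne_zero
  simp only [pow_one, Nat.cast_one, div_one] at h
  have hp := integrable_p_pow 1 pi
  simp only [pow_one] at hp
  rw [← lintegral_one, lintegral_nu measurable_const]
  simp only [mul_one]
  have hi : Integrable (fun w => Real.exp 1 * (1 - p w)) pi :=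
    ((integrable_const _).sub hp).const_mul _
  rw [← ofReal_integral_eq_lintegral_ofReal hi (ae_of_all _ nuDensity_nonneg), integral_const_mul, integral_sub (integrable_const _) hp, h]
  simp [← Real.exp_add]⟩

/-- Since `1 - p ≤ 1`, the density of `nu` is at most `e`; this lets `pi`-estimates control the
chain after a jump. -/
lemma lintegral_nu_le {f : ℝ → ENNReal} (hf : Measurable f) :
    ∫⁻ w, f w ∂nu ≤ ENNReal.ofReal (Real.exp 1) * ∫⁻ w, f w ∂pi := by
  rw [lintegral_nu hf, ← lintegral_const_mul _ hf]
  refine lintegral_mono fun w => ?_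
  gcongr
  nlinarith [Real.exp_pos 1, p_pos w]

lemma integral_nu_neg {E : Type*} [NormedAddCommGroup E] [NormedSpace ℝ E] (f : ℝ → E) :
    ∫ w, f (-w) ∂nu = ∫ w, f w ∂nu := by
  rw [integral_nu, integral_nu, ← integral_pi_neg]
  simp [p_neg]

lemma integral_nu_eq_zero_of_odd {f : ℝ → ℝ} (hf : ∀ w, f (-w) = -f w) : ∫ w, f w ∂nu = 0 := by
  have h := integral_nu_neg f
  simp only [hf, integral_neg] at h
  linarith

lemma integral_pi_eq_zero_of_odd {f : ℝ → ℝ} (hf : ∀ w, f (-w) = -f w) : ∫ w, f w ∂pi = 0 := by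
  have h := integral_pi_neg f
  simp only [hf, integral_neg] at h
  linarith

lemma memLp_g : MemLp g ⊤ pi :=
  memLp_top_of_bound measurable_g.aestronglyMeasurable 1 (ae_of_all _ abs_g_le_one)

/-! ### The transition kernel and its reversibility -/

lemma Q_apply (w : ℝ) :
    Q w = ENNReal.ofReal (p w) • Measure.dirac w + ENNReal.ofReal (1 - p w) • nu := rfl

instance isMarkovKernel_Q : IsMarkovKernel Q := ⟨fun w => ⟨by
  rw [Q_apply]
  simp only [Measure.coe_add, Measure.coe_smul, Pi.add_apply, Pi.smul_apply, measure_univ,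
    smul_eq_mul, mul_one]
  rw [← ENNReal.ofReal_add (p_pos w).le (sub_nonneg.2 (p_le_one w))]
  simp⟩⟩

lemma lintegral_Q {f : ℝ → ENNReal} (hf : Measurable f) (w : ℝ) :
    ∫⁻ z, f z ∂Q w =
      ENNReal.ofReal (p w) * f w + ENNReal.ofReal (1 - p w) * ∫⁻ z, f z ∂nu := by
  rw [Q_apply, lintegral_add_measure, lintegral_smul_measure, lintegral_smul_measure,
    lintegral_dirac' _ hf]
  rfl

lemma integral_Q {E : Type*} [NormedAddCommGroup E] [NormedSpace ℝ E] [CompleteSpace E] {f : ℝ → E}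
    (hf : StronglyMeasurable f) (hfi : Integrable f nu) (w : ℝ) :
    ∫ z, f z ∂Q w = p w • f w + (1 - p w) • ∫ z, f z ∂nu := by
  rw [Q_apply, integral_add_measure, integral_smul_measure, integral_smul_measure,
    integral_dirac' _ _ hf, ENNReal.toReal_ofReal (p_pos w).le,
    ENNReal.toReal_ofReal (sub_nonneg.2 (p_le_one w))]
  · exact Integrable.smul_measure ((integrable_dirac' hf) (by simp)) (by simp)
  · exact hfi.smul_measure (by simp)

/-- The holding part lives on the diagonal, and `(1 - p) dpi = exp (-1) dnu` turns the jump part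
into `exp (-1)` times the product of `nu` with itself. Both are symmetric. -/
lemma isReversible_Q : Kernel.IsReversible Q pi := by
  have key : ∀ A B : Set ℝ, MeasurableSet A → MeasurableSet B → ∫⁻ x in A, Q x B ∂pi =
      ∫⁻ x in A ∩ B, ENNReal.ofReal (p x) ∂pi + ENNReal.ofReal (Real.exp (-1)) * nu A * nu B := by
    intro A B hA hB
    have h1 : ∀ x, Q x B = B.indicator (fun x => ENNReal.ofReal (p x)) x +
        ENNReal.ofReal (1 - p x) * nu B := fun x => by
      rw [Q_apply]
      simp only [Measure.coe_add, Measure.coe_smul, Pi.add_apply, Pi.smul_apply, smul_eq_mul,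
        Measure.dirac_apply' _ hB]
      congr 1
      by_cases hx : x ∈ B <;> simp [hx]
    simp only [h1]
    rw [lintegral_add_left (measurable_p.ennreal_ofReal.indicator hB),
      lintegral_indicator hB, Measure.restrict_restrict hB, Set.inter_comm,
      lintegral_mul_const _ (f := fun x => ENNReal.ofReal (1 - p x))
        (measurable_const.sub measurable_p).ennreal_ofReal]
    congr 2
    rw [nu_eq_withDensity, withDensity_apply _ hA,
      ← lintegral_const_mul _ measurable_nuDensity]
    refine lintegral_congr fun x => ?_
    rw [← ENNReal.ofReal_mul (Real.exp_pos _).le, ← mul_assoc, ← Real.exp_add]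
    simp
  intro A B hA hB
  rw [key A B hA hB, key B A hB hA, Set.inter_comm, mul_assoc, mul_assoc, mul_comm (nu A)]

lemma invariant_Q : pi.bind Q = pi := isReversible_Q.invariant


/-! ### Closed form of the eigenvalue defect -/

open Complex in
-- Both `|x| |Im b|` and `1 - |x| ‖b‖` are at most `‖1 - x b‖`; adding `‖b‖` times the first bound
-- to `|Im b|` times the second eliminates `x`. The uniformity matters because `p` comes arbitrarily
-- close to 1.
lemma abs_im_le_two_mul_norm_mul (b : ℂ) {x : ℝ} :
    |b.im| ≤ 2 * ‖b‖ * ‖1 - x * b‖ := by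
  have him : |x| * |b.im| ≤ ‖1 - x * b‖ := by
    have := abs_im_le_norm (1 - x * b)
    simpa [abs_mul] using this
  have hre : 1 - |x| * ‖b‖ ≤ ‖1 - x * b‖ := by
    have := norm_sub_norm_le (1 : ℂ) (x * b)
    simpa using this
  have hb := abs_im_le_norm b
  have h0 := norm_nonneg (1 - x * b)
  nlinarith [norm_nonneg b, abs_nonneg b.im, abs_nonneg x]

lemma norm_inv_one_sub_mul_le {b : ℂ} (hb : b.im ≠ 0) (x : ℝ) :
    ‖(1 - x * b)⁻¹‖ ≤ 2 * ‖b‖ / |b.im| := by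
  have h := abs_im_le_two_mul_norm_mul b (x := x)
  have him : 0 < |b.im| := abs_pos.2 hb
  have hpos : 0 < ‖1 - x * b‖ := by
    by_contra hc
    have : ‖1 - x * b‖ = 0 := le_antisymm (not_lt.1 hc) (norm_nonneg _)
    rw [this, mul_zero] at h
    linarith
  rw [norm_inv, inv_eq_one_div, div_le_div_iff₀ hpos him]
  linarith

lemma one_sub_mul_ne_zero {b : ℂ} (hb : b.im ≠ 0) (x : ℝ) : 1 - x * b ≠ 0 := by
  intro h
  have := abs_im_le_two_mul_norm_mul b (x := x)
  rw [h, norm_zero, mul_zero] at this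
  exact hb (abs_nonpos_iff.1 this)

/-- The integrand whose mean under the jump law measures the eigenvalue defect. -/
noncomputable def defect (b : ℂ) (w : ℝ) : ℂ := (b - 1) / (1 - p w * b)

lemma measurable_defect (b : ℂ) : Measurable (defect b) := by
  unfold defect
  have := measurable_p
  fun_prop

lemma norm_defect_le {b : ℂ} (hb : b.im ≠ 0) (w : ℝ) :
    ‖defect b w‖ ≤ ‖b - 1‖ * (2 * ‖b‖ / |b.im|) := by
  rw [defect, div_eq_mul_inv, norm_mul]
  gcongr
  exact norm_inv_one_sub_mul_le hb _

open Complex in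
-- The substitution `u = p w` makes the integrand elementary. The hypothesis on `b.im` keeps `1 - u
-- b` off the branch cut of the logarithm.
lemma integral_defect_halfPi {b : ℂ} (hb : b.im ≠ 0) :
    ∫ w, (Real.exp 1 * (1 - p w)) • defect b w ∂halfPi =
      (Real.exp 1 / 2 : ℝ) * ((b - 1) - (b - 1) ^ 2 / b *
        (log (1 - b) - log (1 - b * Real.exp (-1)))) := by
  have hb0 : b ≠ 0 := fun h => hb (by simp [h])
  have hint : Integrable (fun w => (Real.exp 1 * (1 - p w)) • defect b w) halfPi := by
    refine integrable_of_norm_le (C := Real.exp 1 * (‖b - 1‖ * (2 * ‖b‖ / |b.im|))) ?_ fun w => ?_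
    · exact (((measurable_const.sub measurable_p).const_mul _).smul
        (measurable_defect b)).aestronglyMeasurable
    · rw [norm_smul, Real.norm_of_nonneg (nuDensity_nonneg w)]
      gcongr
      · nlinarith [Real.exp_pos 1, p_pos w]
      · exact norm_defect_le hb w
  rw [halfPi, integrable_withDensity_iff_integrable_smul' measurable_density (by simp)] at hint
  rw [integral_halfPi]
  have hslit : ∀ x : ℝ, x ≠ 0 → 1 - x * b ∈ slitPlane := fun x hx =>
    Or.inr (by simp [hx, hb])
  -- This primitive comes from `(1 - p) / (1 - p b) = 1 + p (b - 1) / (1 - p b)`: the first term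
  -- integrates to `1 / w`, the second to a logarithm.
  set F : ℝ → ℂ := fun w => (-(Real.exp 1 / 2) : ℝ) *
    ((b - 1) * (w⁻¹ : ℝ) + (b - 1) ^ 2 / b * log (1 - (Real.exp (-1 / w) : ℝ) * b)) with hF
  have hderiv : ∀ x ∈ Set.Ici (1 : ℝ), HasDerivAt F
      ((1 / (2 * x ^ 2)) • (Real.exp 1 * (1 - p x)) • defect b x) x := fun x hx => by
    have hx1 : (0 : ℝ) < x := lt_of_lt_of_le one_pos hx
    have hx0 : x ≠ 0 := hx1.ne'
    have h1 := ((hasDerivAt_inv hx0).ofReal_comp).const_mul (b - 1)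
    have h2 := (((hasDerivAt_exp_neg_div 1 hx0).ofReal_comp).mul_const b).const_sub 1
    have h3 := (h2.clog_real (hslit _ (Real.exp_pos _).ne')).const_mul ((b - 1) ^ 2 / b)
    have h4 := (h1.add h3).const_mul ((-(Real.exp 1 / 2) : ℝ) : ℂ)
    refine h4.congr_deriv ?_
    have hne : 1 - (Real.exp (-1 / x) : ℝ) * b ≠ 0 := one_sub_mul_ne_zero hb _
    have hxc : (x : ℂ) ≠ 0 := by exact_mod_cast hx0
    rw [defect, p_of_pos hx1]
    generalize hE : Real.exp (-1 / x) = E at *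
    generalize Real.exp 1 = e
    simp only [real_smul]
    push_cast
    have hne' : 1 - b * (E : ℂ) ≠ 0 := by rwa [mul_comm]
    rw [mul_comm (E : ℂ) b]
    field_simp
    ring
  have hlim : Tendsto F atTop (𝓝 ((-(Real.exp 1 / 2) : ℝ) *
      ((b - 1) * (0 : ℝ) + (b - 1) ^ 2 / b * log (1 - (1 : ℝ) * b)))) := by
    refine Tendsto.const_mul _ (Tendsto.add (Tendsto.const_mul _ ?_) (Tendsto.const_mul _ ?_))
    · exact (continuous_ofReal.tendsto _).comp tendsto_inv_atTop_zero
    · have hc : ContinuousAt (fun y : ℝ => log (1 - (y : ℂ) * b)) 1 := by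
        refine ContinuousAt.clog (by fun_prop) (hslit 1 one_ne_zero)
      have h0 : Tendsto (fun w : ℝ => Real.exp (-1 / w)) atTop (𝓝 1) := by
        have := (Real.continuous_exp.tendsto 0).comp (tendsto_const_div_atTop (-1))
        rwa [Real.exp_zero] at this
      exact hc.tendsto.comp h0
  have hint' : IntegrableOn
      (fun x : ℝ => (1 / (2 * x ^ 2)) • (Real.exp 1 * (1 - p x)) • defect b x) (Set.Ioi 1) := by
    refine hint.congr (ae_of_all _ fun x => ?_)
    simp only
    rw [ENNReal.toReal_ofReal (by positivity)]
  rw [integral_Ioi_of_hasDerivAt_of_tendsto' hderiv hint' hlim]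
  simp only [hF]
  push_cast
  rw [mul_comm b]
  norm_num
  ring

/-- One step multiplier `exp (δ + i a g(w))`. -/
noncomputable def tilt (a δ w : ℝ) : ℂ := Complex.exp (δ + a * g w * Complex.I)

lemma measurable_tilt (a δ : ℝ) : Measurable (tilt a δ) := by
  unfold tilt
  have := measurable_g
  fun_prop

/-- The multiplier on the positive half line. -/
noncomputable def mult (a δ : ℝ) : ℂ := Complex.exp (δ + a * Complex.I)

/-- On each half line the tilt is constant, equal to the multiplier with frequency `a` or `-a`, so
the half-line formula applies twice. -/
lemma integral_defect_nu {a δ : ℝ} (h1 : (mult a δ).im ≠ 0) (h2 : (mult (-a) δ).im ≠ 0)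
    (hint : Integrable (fun w => defect (tilt a δ w) w) nu) :
    ∫ w, defect (tilt a δ w) w ∂nu =
      (Real.exp 1 / 2 : ℝ) * (((mult a δ - 1) + (mult (-a) δ - 1)) -
      ((mult a δ - 1) ^ 2 / mult a δ * (Complex.log (1 - mult a δ) -
        Complex.log (1 - mult a δ * Real.exp (-1))) +
       (mult (-a) δ - 1) ^ 2 / mult (-a) δ * (Complex.log (1 - mult (-a) δ) -
        Complex.log (1 - mult (-a) δ * Real.exp (-1))))) := by
  have hpos : ∀ᵐ w ∂halfPi, (0 : ℝ) < w := by
    refine (withDensity_absolutelyContinuous _ _).ae_le ?_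
    filter_upwards [ae_restrict_mem measurableSet_Ioi] with w hw
    exact lt_trans one_pos hw
  rw [nu_eq_withDensity,
    integrable_withDensity_iff_integrable_smul' measurable_nuDensity (by simp)] at hint
  have hint' : Integrable (fun w => (Real.exp 1 * (1 - p w)) • defect (tilt a δ w) w) pi := by
    refine hint.congr (ae_of_all _ fun w => ?_)
    simp only
    rw [ENNReal.toReal_ofReal (nuDensity_nonneg w)]
  rw [integral_nu, integral_pi_eq hint']
  have e1 : ∫ w, (Real.exp 1 * (1 - p w)) • defect (tilt a δ w) w ∂halfPi =
      ∫ w, (Real.exp 1 * (1 - p w)) • defect (mult a δ) w ∂halfPi := by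
    refine integral_congr_ae ?_
    filter_upwards [hpos] with w hw
    simp [tilt, mult, g_of_pos hw]
  have e2 : ∫ w, (Real.exp 1 * (1 - p (-w))) • defect (tilt a δ (-w)) (-w) ∂halfPi =
      ∫ w, (Real.exp 1 * (1 - p w)) • defect (mult (-a) δ) w ∂halfPi := by
    refine integral_congr_ae ?_
    filter_upwards [hpos] with w hw
    simp [tilt, mult, g_neg, g_of_pos hw, p_neg, defect]
  rw [e1, e2, integral_defect_halfPi h1, integral_defect_halfPi h2]
  ring


/-! ### Asymptotics of the multiplier when `a_n² n log n → 2 s` and `δ = s / n` -/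

section Asymptotics

variable {a : ℕ → ℝ} {s : ℝ}

lemma tendsto_log_nat_atTop : Tendsto (fun n : ℕ => Real.log n) atTop atTop :=
  Real.tendsto_log_atTop.comp tendsto_natCast_atTop_atTop

lemma tendsto_log_div_nat : Tendsto (fun n : ℕ => Real.log n / n) atTop (𝓝 0) := by
  have := (Real.isLittleO_log_id_atTop.tendsto_div_nhds_zero).comp tendsto_natCast_atTop_atTop
  exact this

lemma tendsto_nat_mul_log : Tendsto (fun n : ℕ => (n : ℝ) * Real.log n) atTop atTop :=
  tendsto_natCast_atTop_atTop.atTop_mul_atTop₀ tendsto_log_nat_atTop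

lemma eventually_log_pos : ∀ᶠ n : ℕ in atTop, 0 < Real.log n :=
  tendsto_log_nat_atTop.eventually_gt_atTop 0

lemma tendsto_sq_mul_nat (h : Tendsto (fun n : ℕ => a n ^ 2 * (n * Real.log n)) atTop (𝓝 (2 * s))) :
    Tendsto (fun n : ℕ => a n ^ 2 * n) atTop (𝓝 0) := by
  refine (h.div_atTop tendsto_log_nat_atTop).congr' ?_
  filter_upwards [eventually_log_pos] with n hn
  field_simp

lemma tendsto_freq_zero
    (h : Tendsto (fun n : ℕ => a n ^ 2 * (n * Real.log n)) atTop (𝓝 (2 * s))) :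
    Tendsto a atTop (𝓝 0) := by
  have h2 : Tendsto (fun n => a n ^ 2) atTop (𝓝 0) := by
    refine (h.div_atTop tendsto_nat_mul_log).congr' ?_
    filter_upwards [eventually_log_pos, eventually_gt_atTop 0] with n hn hn0
    have : (0 : ℝ) < n := by exact_mod_cast hn0
    field_simp
  have h3 := h2.sqrt
  simp only [Real.sqrt_sq_eq_abs, Real.sqrt_zero] at h3
  exact (tendsto_zero_iff_abs_tendsto_zero _).2 h3

lemma eventually_freq_ne_zero (hs : 0 < s)
    (h : Tendsto (fun n : ℕ => a n ^ 2 * (n * Real.log n)) atTop (𝓝 (2 * s))) :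
    ∀ᶠ n in atTop, a n ≠ 0 := by
  filter_upwards [h.eventually_ne (show (2 * s) ≠ 0 by positivity)] with n hn h0
  simp [h0] at hn

/-- The square equals `s² (log n / n) / (a_n² n log n)`. So the real shift is negligible against the
frequency, and `b - 1` behaves like `i a_n`. -/
lemma tendsto_shift_div_freq (hs : 0 < s)
    (h : Tendsto (fun n : ℕ => a n ^ 2 * (n * Real.log n)) atTop (𝓝 (2 * s))) :
    Tendsto (fun n : ℕ => s / n / a n) atTop (𝓝 0) := by
  have h2 : Tendsto (fun n : ℕ => (s / n / a n) ^ 2) atTop (𝓝 0) := by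
    have := ((tendsto_log_div_nat.const_mul (s ^ 2)).div h (by positivity))
    simp only [mul_zero, zero_div] at this
    refine this.congr' ?_
    filter_upwards [eventually_log_pos, eventually_gt_atTop 0, eventually_freq_ne_zero hs h]
      with n hn hn0 ha
    have : (0 : ℝ) < n := by exact_mod_cast hn0
    simp only [Pi.div_apply]
    field_simp
  have h3 := h2.sqrt
  simp only [Real.sqrt_sq_eq_abs, Real.sqrt_zero] at h3
  exact (tendsto_zero_iff_abs_tendsto_zero _).2 h3

lemma tendsto_const_div_nat (s : ℝ) : Tendsto (fun n : ℕ => s / n) atTop (𝓝 0) :=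
  tendsto_const_nhds.div_atTop tendsto_natCast_atTop_atTop

lemma tendsto_exponent (h : Tendsto (fun n : ℕ => a n ^ 2 * (n * Real.log n)) atTop (𝓝 (2 * s))) :
    Tendsto (fun n : ℕ => (((s / n : ℝ) : ℂ) + a n * Complex.I)) atTop (𝓝 0) := by
  have h1 := (Complex.continuous_ofReal.tendsto _).comp (tendsto_const_div_nat s)
  have h2 := (Complex.continuous_ofReal.tendsto _).comp (tendsto_freq_zero h)
  simpa using h1.add (h2.mul_const Complex.I)

lemma tendsto_mult (h : Tendsto (fun n : ℕ => a n ^ 2 * (n * Real.log n)) atTop (𝓝 (2 * s))) :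
    Tendsto (fun n : ℕ => mult (a n) (s / n)) atTop (𝓝 1) := by
  have := (Complex.continuous_exp.tendsto 0).comp (tendsto_exponent h)
  rwa [Complex.exp_zero] at this

lemma tendsto_mult_sub_one_div (hs : 0 < s)
    (h : Tendsto (fun n : ℕ => a n ^ 2 * (n * Real.log n)) atTop (𝓝 (2 * s))) :
    Tendsto (fun n : ℕ => (mult (a n) (s / n) - 1) / a n) atTop (𝓝 Complex.I) := by
  have hslope := (Complex.hasDerivAt_exp 0).tendsto_slope
  have hz : ∀ᶠ n : ℕ in atTop, (((s / n : ℝ) : ℂ) + a n * Complex.I) ≠ 0 := by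
    filter_upwards [eventually_freq_ne_zero hs h] with n hn h0
    have := congrArg Complex.im h0
    rw [Complex.add_im, Complex.ofReal_im] at this
    simp at this
    exact hn this
  have h1 := hslope.comp (tendsto_nhdsWithin_iff.2 ⟨tendsto_exponent h, hz⟩)
  have h2 := ((Complex.continuous_ofReal.tendsto _).comp
    (tendsto_shift_div_freq hs h)).add_const Complex.I
  have h3 := h1.mul h2
  rw [Complex.exp_zero, one_mul, Complex.ofReal_zero, zero_add] at h3
  refine h3.congr' ?_
  filter_upwards [hz, eventually_freq_ne_zero hs h] with n hn ha
  have ha' : (a n : ℂ) ≠ 0 := by exact_mod_cast ha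
  simp only [Function.comp, slope_def_field, Complex.exp_zero, sub_zero, mult]
  rw [div_mul_eq_mul_div, div_eq_div_iff hn ha']
  push_cast
  field_simp

lemma tendsto_mult_sub_one_sq (hs : 0 < s)
    (h : Tendsto (fun n : ℕ => a n ^ 2 * (n * Real.log n)) atTop (𝓝 (2 * s))) :
    Tendsto (fun n : ℕ => (mult (a n) (s / n) - 1) ^ 2 * ((n * Real.log n : ℝ) : ℂ)) atTop
      (𝓝 (-2 * (s : ℂ))) := by
  have h1 := ((tendsto_mult_sub_one_div hs h).pow 2).mul
    ((Complex.continuous_ofReal.tendsto _).comp h)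
  rw [Complex.I_sq] at h1
  have e : -2 * (s : ℂ) = -1 * ((2 * s : ℝ) : ℂ) := by push_cast; ring
  rw [e]
  refine h1.congr' ?_
  filter_upwards [eventually_freq_ne_zero hs h] with n ha
  have ha' : (a n : ℂ) ≠ 0 := by exact_mod_cast ha
  simp only [Function.comp]
  push_cast
  field_simp

lemma tendsto_im_div_freq (hs : 0 < s)
    (h : Tendsto (fun n : ℕ => a n ^ 2 * (n * Real.log n)) atTop (𝓝 (2 * s))) :
    Tendsto (fun n : ℕ => (mult (a n) (s / n)).im / a n) atTop (𝓝 1) := by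
  have := (Complex.continuous_im.tendsto _).comp (tendsto_mult_sub_one_div hs h)
  rw [Complex.I_im] at this
  refine this.congr fun n => ?_
  simp only [Function.comp, Complex.div_ofReal_im, Complex.sub_im, Complex.one_im, sub_zero]

lemma eventually_mult_im_ne_zero (hs : 0 < s)
    (h : Tendsto (fun n : ℕ => a n ^ 2 * (n * Real.log n)) atTop (𝓝 (2 * s))) :
    ∀ᶠ n : ℕ in atTop, (mult (a n) (s / n)).im ≠ 0 := by
  filter_upwards [(tendsto_im_div_freq hs h).eventually_ne one_ne_zero] with n hn h0
  simp [h0] at hn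

/-- The left side tends to 2, so any constant above 2 would serve. It bounds the defect integrand
uniformly in the state. -/
lemma eventually_bound_le_three (hs : 0 < s)
    (h : Tendsto (fun n : ℕ => a n ^ 2 * (n * Real.log n)) atTop (𝓝 (2 * s))) :
    ∀ᶠ n : ℕ in atTop, ‖mult (a n) (s / n) - 1‖ *
      (2 * ‖mult (a n) (s / n)‖ / |(mult (a n) (s / n)).im|) ≤ 3 := by
  have h1 := (tendsto_mult_sub_one_div hs h).norm
  have h2 := (tendsto_mult h).norm
  have h3 := (tendsto_im_div_freq hs h).abs
  rw [Complex.norm_I] at h1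
  rw [norm_one] at h2
  rw [abs_one] at h3
  have h4 := h1.mul ((h2.const_mul 2).div h3 one_ne_zero)
  filter_upwards [h4.eventually_le_const (show (1 : ℝ) * (2 * 1 / 1) < 3 by norm_num),
    eventually_freq_ne_zero hs h, eventually_mult_im_ne_zero hs h] with n hn ha him
  refine le_trans (le_of_eq ?_) hn
  have ha' : 0 < |a n| := abs_pos.2 ha
  have him' : 0 < |(mult (a n) (s / n)).im| := abs_pos.2 him
  simp only [Pi.div_apply]
  rw [norm_div, Complex.norm_real, Real.norm_eq_abs, abs_div]
  field_simp

/-- Since `‖1 - b‖² n log n` has a positive limit, `log ‖1 - b‖ = -(log n + log log n) / 2 + O(1)`;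
the argument is bounded by `Real.pi`, hence negligible. -/
lemma tendsto_log_one_sub_mult_div_log (hs : 0 < s)
    (h : Tendsto (fun n : ℕ => a n ^ 2 * (n * Real.log n)) atTop (𝓝 (2 * s))) :
    Tendsto (fun n : ℕ => Complex.log (1 - mult (a n) (s / n)) / (Real.log n : ℝ)) atTop
      (𝓝 (-1 / 2)) := by
  have hnorm : Tendsto (fun n : ℕ => ‖1 - mult (a n) (s / n)‖ ^ 2 * (n * Real.log n)) atTop
      (𝓝 (2 * s)) := by
    have := (tendsto_mult_sub_one_sq hs h).norm
    have e : ‖-2 * (s : ℂ)‖ = 2 * s := by simp [abs_of_pos hs]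
    rw [e] at this
    refine this.congr' ?_
    filter_upwards [eventually_log_pos] with n hn
    rw [norm_mul, norm_pow, Complex.norm_real, norm_sub_rev, Real.norm_of_nonneg (by positivity)]
  have hlog := hnorm.log (by positivity)
  have hloglog : Tendsto (fun n : ℕ => Real.log (Real.log n) / Real.log n) atTop (𝓝 0) :=
    (Real.isLittleO_log_id_atTop.tendsto_div_nhds_zero).comp tendsto_log_nat_atTop
  have hre : Tendsto (fun n : ℕ => Real.log ‖1 - mult (a n) (s / n)‖ / Real.log n) atTop
      (𝓝 (-1 / 2)) := by
    have h5 := (((hlog.div_atTop tendsto_log_nat_atTop).sub hloglog).sub_const 1).div_const 2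
    rw [show ((0 : ℝ) - 0 - 1) / 2 = -1 / 2 by norm_num] at h5
    refine h5.congr' ?_
    filter_upwards [eventually_log_pos, eventually_gt_atTop 0,
      hnorm.eventually_ne (show 2 * s ≠ 0 by positivity)] with n hn hn0 hne
    have hn1 : (n : ℝ) ≠ 0 := by exact_mod_cast hn0.ne'
    rw [Real.log_mul (left_ne_zero_of_mul hne) (right_ne_zero_of_mul hne),
      Real.log_mul hn1 hn.ne', Real.log_pow]
    push_cast
    field_simp
    ring
  have him : Tendsto (fun n : ℕ => Complex.arg (1 - mult (a n) (s / n)) / Real.log n) atTop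
      (𝓝 0) := by
    have hb : Tendsto (fun n : ℕ => Real.pi / Real.log n) atTop (𝓝 0) :=
      tendsto_const_nhds.div_atTop tendsto_log_nat_atTop
    refine squeeze_zero_norm' ?_ hb
    filter_upwards [eventually_log_pos] with n hn
    rw [norm_div, Real.norm_eq_abs, Real.norm_of_nonneg hn.le]
    gcongr
    exact Complex.abs_arg_le_pi _
  have h6 := ((Complex.continuous_ofReal.tendsto _).comp hre).add
    (((Complex.continuous_ofReal.tendsto _).comp him).mul_const Complex.I)
  have e : (((-1 / 2 : ℝ) : ℂ) + ((0 : ℝ) : ℂ) * Complex.I) = -1 / 2 := by push_cast; ring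
  rw [e] at h6
  refine h6.congr fun n => ?_
  simp only [Function.comp, Complex.log]
  push_cast
  ring

/-- The square is about `-2 s / (n log n)` and the singular logarithm about `-(log n) / 2`, whose
product is `s / n`. The other logarithm stays bounded and loses by a factor `log n`. -/
lemma tendsto_nat_mul_log_part (hs : 0 < s)
    (h : Tendsto (fun n : ℕ => a n ^ 2 * (n * Real.log n)) atTop (𝓝 (2 * s))) :
    Tendsto (fun n : ℕ => (n : ℂ) * ((mult (a n) (s / n) - 1) ^ 2 / mult (a n) (s / n) *
      (Complex.log (1 - mult (a n) (s / n)) -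
        Complex.log (1 - mult (a n) (s / n) * Real.exp (-1))))) atTop (𝓝 (s : ℂ)) := by
  have hinv := (tendsto_mult h).inv₀ one_ne_zero
  have hsq := tendsto_mult_sub_one_sq hs h
  have h1 := (hsq.mul hinv).mul (tendsto_log_one_sub_mult_div_log hs h)
  have hsq0 : Tendsto (fun n : ℕ => (mult (a n) (s / n) - 1) ^ 2 * (n : ℂ)) atTop (𝓝 0) := by
    have hl : Tendsto (fun n : ℕ => (((Real.log n)⁻¹ : ℝ) : ℂ)) atTop (𝓝 0) := by
      have := (Complex.continuous_ofReal.tendsto _).comp tendsto_log_nat_atTop.inv_tendsto_atTop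
      rwa [Complex.ofReal_zero] at this
    have := hsq.mul hl
    rw [mul_zero] at this
    refine this.congr' ?_
    filter_upwards [eventually_log_pos] with n hn
    have : ((Real.log n : ℝ) : ℂ) ≠ 0 := by exact_mod_cast hn.ne'
    push_cast at this ⊢
    field_simp
  have hlog2 : Tendsto (fun n : ℕ => Complex.log (1 - mult (a n) (s / n) * Real.exp (-1))) atTop
      (𝓝 (Complex.log (1 - 1 * Real.exp (-1)))) := by
    refine (((tendsto_mult h).mul_const _).const_sub 1).clog (Or.inl ?_)
    have : Real.exp (-1) < 1 := Real.exp_lt_one_iff.2 (by norm_num)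
    rw [one_mul, ← Complex.ofReal_one, ← Complex.ofReal_sub, Complex.ofReal_re]
    linarith
  have h2 := (hsq0.mul hinv).mul hlog2
  have h3 := h1.sub h2
  have e : -2 * (s : ℂ) * 1⁻¹ * (-1 / 2) -
      0 * 1⁻¹ * Complex.log (1 - 1 * Real.exp (-1)) = s := by
    ring
  rw [e] at h3
  refine h3.congr' ?_
  filter_upwards [eventually_log_pos] with n hn
  have : ((Real.log n : ℝ) : ℂ) ≠ 0 := by exact_mod_cast hn.ne'
  have hm : mult (a n) (s / n) ≠ 0 := Complex.exp_ne_zero _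
  push_cast at this ⊢
  field_simp

/-- The imaginary parts of order `a_n` cancel, leaving `2 n (exp (s / n) cos a_n - 1)`. The cosine
costs only `O(n a_n²) = o(1)`. -/
lemma tendsto_nat_mul_mult_add (hs : 0 < s)
    (h : Tendsto (fun n : ℕ => a n ^ 2 * (n * Real.log n)) atTop (𝓝 (2 * s))) :
    Tendsto (fun n : ℕ => (n : ℂ) * ((mult (a n) (s / n) - 1) + (mult (-a n) (s / n) - 1))) atTop
      (𝓝 (2 * (s : ℂ))) := by
  have hmul : ∀ n : ℕ, (n : ℂ) * ((mult (a n) (s / n) - 1) + (mult (-a n) (s / n) - 1)) =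
      ((2 * ((n * (Real.exp (s / n) - 1)) * Real.cos (a n)
        - n * (1 - Real.cos (a n))) : ℝ) : ℂ) := fun n => by
    have e1 : mult (a n) (s / n) + mult (-a n) (s / n) =
        2 * Complex.exp ((s / n : ℝ) : ℂ) * Complex.cos (a n) := by
      rw [mult, mult, Complex.exp_add, Complex.exp_add, Complex.cos]
      push_cast
      ring
    have e2 : (mult (a n) (s / n) - 1) + (mult (-a n) (s / n) - 1) =
      2 * Complex.exp ((s / n : ℝ) : ℂ) * Complex.cos (a n) - 2 := by rw [← e1]; ring
    rw [e2]
    push_cast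
    ring
  simp only [hmul]
  have hexp : Tendsto (fun n : ℕ => (n : ℝ) * (Real.exp (s / n) - 1)) atTop (𝓝 s) := by
    have hslope := (Real.hasDerivAt_exp 0).tendsto_slope
    have hz : ∀ᶠ n : ℕ in atTop, s / n ≠ 0 := by
      filter_upwards [eventually_gt_atTop 0] with n hn
      have : (0 : ℝ) < n := by exact_mod_cast hn
      positivity
    have h1 := (hslope.comp (tendsto_nhdsWithin_iff.2 ⟨tendsto_const_div_nat s, hz⟩)).mul_const s
    rw [Real.exp_zero, one_mul] at h1
    refine h1.congr' ?_
    filter_upwards [eventually_gt_atTop 0] with n hn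
    have : (0 : ℝ) < n := by exact_mod_cast hn
    simp only [Function.comp, slope_def_field, Real.exp_zero, sub_zero]
    field_simp
  have hcos : Tendsto (fun n : ℕ => Real.cos (a n)) atTop (𝓝 1) := by
    have := (Real.continuous_cos.tendsto 0).comp (tendsto_freq_zero h)
    rwa [Real.cos_zero] at this
  have hcos2 : Tendsto (fun n : ℕ => (n : ℝ) * (1 - Real.cos (a n))) atTop (𝓝 0) := by
    refine squeeze_zero (fun n => mul_nonneg (Nat.cast_nonneg n)
      (sub_nonneg.2 (Real.cos_le_one _))) (fun n => ?_) (tendsto_sq_mul_nat h)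
    have := Real.one_sub_sq_div_two_le_cos (x := a n)
    have hn : (0 : ℝ) ≤ n := Nat.cast_nonneg n
    nlinarith [sq_nonneg (a n), mul_nonneg hn (sq_nonneg (a n))]
  have h5 := ((hexp.mul hcos).sub hcos2).const_mul 2
  rw [mul_one, sub_zero] at h5
  have h6 := (Complex.continuous_ofReal.tendsto _).comp h5
  push_cast at h6
  exact h6

end Asymptotics


/-! ### The chain with its partial sum as a kernel in the starting point -/

/-- The law of `(S_n, W_n)` given `W_0`. -/
noncomputable def sumState : ℕ → Kernel ℝ (ℝ × ℝ)
  | 0 => Kernel.deterministic (fun w => (0, w)) (by fun_prop)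
  | n + 1 => ((sumState n) ⊗ₖ (Q.comap (fun q : ℝ × ℝ × ℝ => q.2.2) (by fun_prop))).map
      (fun q : (ℝ × ℝ) × ℝ => (q.1.1 + g q.2, q.2))

lemma measurable_sumStep : Measurable (fun q : (ℝ × ℝ) × ℝ => (q.1.1 + g q.2, q.2)) := by
  have := measurable_g
  fun_prop

instance isMarkovKernel_sumState (n : ℕ) : IsMarkovKernel (sumState n) := by
  induction n with
  | zero => unfold sumState; infer_instance
  | succ n ih => unfold sumState; exact Kernel.IsMarkovKernel.map _ measurable_sumStep

lemma lintegral_sumState_succ (n : ℕ) (w : ℝ) {f : ℝ × ℝ → ENNReal} (hf : Measurable f) :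
    ∫⁻ y, f y ∂sumState (n + 1) w =
      ∫⁻ y, ∫⁻ z, f (y.1 + g z, z) ∂Q y.2 ∂sumState n w := by
  have hf' : Measurable fun q : (ℝ × ℝ) × ℝ => f (q.1.1 + g q.2, q.2) := hf.comp measurable_sumStep
  rw [sumState, Kernel.lintegral_map _ measurable_sumStep _ hf, Kernel.lintegral_compProd _ _ _ hf']
  rfl

lemma integral_sumState_succ (n : ℕ) (w : ℝ) {f : ℝ × ℝ → ℂ} (hf : Measurable f) {C : ℝ}
    (hC : ∀ y, ‖f y‖ ≤ C) :
    ∫ y, f y ∂sumState (n + 1) w = ∫ y, ∫ z, f (y.1 + g z, z) ∂Q y.2 ∂sumState n w := by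
  have hf' : Measurable fun q : (ℝ × ℝ) × ℝ => f (q.1.1 + g q.2, q.2) := hf.comp measurable_sumStep
  rw [sumState, Kernel.map_apply _ measurable_sumStep,
    integral_map measurable_sumStep.aemeasurable hf.aestronglyMeasurable,
    integral_compProd (integrable_of_norm_le hf'.aestronglyMeasurable fun _ => hC _)]
  rfl

lemma lintegral_bind_Q {f : ℝ → ENNReal} (hf : Measurable f) :
    ∫⁻ x, ∫⁻ z, f z ∂Q x ∂pi = ∫⁻ x, f x ∂pi := by
  conv_rhs => rw [← invariant_Q]
  rw [Measure.lintegral_bind Q.aemeasurable hf.aemeasurable]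

/-- With probability `p w ^ n` no jump has been attempted and the chain still sits at `w`. Otherwise
its law is dominated by `e pi`, because `nu` is and `pi` is invariant. The induction applies the
hypothesis to `Q f`. -/
lemma lintegral_sumState_le (n : ℕ) (w : ℝ) {f : ℝ → ENNReal} (hf : Measurable f) :
    ∫⁻ y, f y.2 ∂sumState n w ≤ ENNReal.ofReal (p w ^ n) * f w +
      ENNReal.ofReal (1 - p w ^ n) * (ENNReal.ofReal (Real.exp 1) * ∫⁻ x, f x ∂pi) := by
  induction n generalizing f with
  | zero =>
    have hm : Measurable fun y : ℝ × ℝ => f y.2 := by fun_prop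
    rw [sumState, Kernel.deterministic_apply, lintegral_dirac' _ hm]
    simp
  | succ n ih =>
    have hm : Measurable fun y : ℝ × ℝ => f y.2 := by fun_prop
    have hQ : Measurable fun x => ∫⁻ z, f z ∂Q x := hf.lintegral_kernel
    have hp0 := p_pos w
    have hp1 := p_le_one w
    have hpn : 0 ≤ p w ^ n := pow_nonneg hp0.le n
    have hpn1 : p w ^ n ≤ 1 := pow_le_one₀ hp0.le hp1
    rw [lintegral_sumState_succ n w hm]
    refine (ih hQ).trans ?_
    rw [lintegral_bind_Q hf, lintegral_Q hf]
    set A := ENNReal.ofReal (Real.exp 1) * ∫⁻ x, f x ∂pi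
    calc ENNReal.ofReal (p w ^ n) * (ENNReal.ofReal (p w) * f w +
          ENNReal.ofReal (1 - p w) * ∫⁻ z, f z ∂nu) + ENNReal.ofReal (1 - p w ^ n) * A
        ≤ ENNReal.ofReal (p w ^ n) * (ENNReal.ofReal (p w) * f w +
          ENNReal.ofReal (1 - p w) * A) + ENNReal.ofReal (1 - p w ^ n) * A := by
          gcongr
          exact lintegral_nu_le hf
      _ = ENNReal.ofReal (p w ^ (n + 1)) * f w + ENNReal.ofReal (1 - p w ^ (n + 1)) * A := by
          rw [mul_add, ← mul_assoc, ← mul_assoc, ← ENNReal.ofReal_mul hpn,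
            ← ENNReal.ofReal_mul hpn, add_assoc, ← add_mul, ← ENNReal.ofReal_add
            (mul_nonneg hpn (sub_nonneg.2 hp1)) (sub_nonneg.2 hpn1), ← pow_succ]
          congr 3
          ring

lemma lintegral_sumState_le_add (n : ℕ) (w : ℝ) {f : ℝ → ENNReal} (hf : Measurable f) :
    ∫⁻ y, f y.2 ∂sumState n w ≤ f w + ENNReal.ofReal (Real.exp 1) * ∫⁻ x, f x ∂pi := by
  refine (lintegral_sumState_le n w hf).trans ?_
  have hpn : 0 ≤ p w ^ n := pow_nonneg (p_pos w).le n
  have hpn1 : p w ^ n ≤ 1 := pow_le_one₀ (p_pos w).le (p_le_one w)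
  refine add_le_add (mul_le_of_le_one_left' ?_) (mul_le_of_le_one_left' ?_) <;>
    exact ENNReal.ofReal_le_one.2 (by linarith)

/-! ### The approximate eigenfunction -/

/-- The approximate eigenfunction of the tilted transition operator. -/
noncomputable def eigenfn (a δ w : ℝ) : ℂ := (1 - p w) / (1 - p w * tilt a δ w)

lemma measurable_eigenfn (a δ : ℝ) : Measurable (eigenfn a δ) := by
  unfold eigenfn
  have := measurable_p
  have := measurable_tilt a δ
  fun_prop

lemma mult_neg (a δ : ℝ) : mult (-a) δ = (starRingEnd ℂ) (mult a δ) := by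
  simp [mult, ← Complex.exp_conj]

lemma tilt_eq_or {w : ℝ} (hw : w ≠ 0) (a δ : ℝ) :
    tilt a δ w = mult a δ ∨ tilt a δ w = mult (-a) δ := by
  rcases Real.sign_apply_eq_of_ne_zero w hw with h | h
  · right; simp [tilt, mult, g, h]
  · left; simp [tilt, mult, g, h]

lemma p_zero : p 0 = 1 := by simp [p]

section Tilted

variable {a δ : ℝ}

lemma tilt_im_ne_zero (him : (mult a δ).im ≠ 0) {w : ℝ} (hw : w ≠ 0) : (tilt a δ w).im ≠ 0 := by
  rcases tilt_eq_or hw a δ with h | h <;> rw [h]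
  · exact him
  · simpa [mult_neg] using him

lemma norm_defect_tilt_le (him : (mult a δ).im ≠ 0)
    (hB : ‖mult a δ - 1‖ * (2 * ‖mult a δ‖ / |(mult a δ).im|) ≤ 3) (w : ℝ) :
    ‖defect (tilt a δ w) w‖ ≤ 3 := by
  -- At the state 0 the conventions give `p = 1` and `g = 0`, so the tilt is real and the
  -- imaginary-part bound is unavailable; there the defect is a quotient `(b - 1) / (1 - b)`.
  rcases eq_or_ne w 0 with rfl | hw
  · rw [defect, p_zero, Complex.ofReal_one, one_mul, norm_div, norm_sub_rev]
    exact (div_self_le_one _).trans (by norm_num)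
  · refine (norm_defect_le (tilt_im_ne_zero him hw) w).trans ?_
    rcases tilt_eq_or hw a δ with h | h <;> rw [h]
    · exact hB
    · rw [mult_neg, ← map_one (starRingEnd ℂ), ← map_sub, Complex.norm_conj, Complex.norm_conj,
        Complex.conj_im, abs_neg]
      exact hB

lemma eigenfn_mul (him : (mult a δ).im ≠ 0) (w : ℝ) :
    eigenfn a δ w * (1 - p w * tilt a δ w) = 1 - p w := by
  rcases eq_or_ne w 0 with rfl | hw
  · simp [eigenfn, p_zero]
  · exact div_mul_cancel₀ _ (one_sub_mul_ne_zero (tilt_im_ne_zero him hw) _)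

lemma eigenfn_sub_one (him : (mult a δ).im ≠ 0) {w : ℝ} (hw : w ≠ 0) :
    eigenfn a δ w - 1 = p w * defect (tilt a δ w) w := by
  have h := one_sub_mul_ne_zero (tilt_im_ne_zero him hw) (p w)
  rw [eigenfn, defect]
  field_simp
  ring

lemma norm_eigenfn_sub_one_le (him : (mult a δ).im ≠ 0)
    (hB : ‖mult a δ - 1‖ * (2 * ‖mult a δ‖ / |(mult a δ).im|) ≤ 3) (w : ℝ) :
    ‖eigenfn a δ w - 1‖ ≤ 3 := by
  rcases eq_or_ne w 0 with rfl | hw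
  · simp [eigenfn, p_zero]
  · rw [eigenfn_sub_one him hw, norm_mul, Complex.norm_real, Real.norm_of_nonneg (p_pos w).le]
    have := norm_defect_tilt_le him hB w
    nlinarith [norm_nonneg (defect (tilt a δ w) w), p_le_one w, p_pos w]

lemma norm_eigenfn_le (him : (mult a δ).im ≠ 0)
    (hB : ‖mult a δ - 1‖ * (2 * ‖mult a δ‖ / |(mult a δ).im|) ≤ 3) (w : ℝ) :
    ‖eigenfn a δ w‖ ≤ 4 := by
  have h := norm_eigenfn_sub_one_le him hB w
  calc ‖eigenfn a δ w‖ = ‖(eigenfn a δ w - 1) + 1‖ := by rw [sub_add_cancel]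
    _ ≤ ‖eigenfn a δ w - 1‖ + ‖(1 : ℂ)‖ := norm_add_le _ _
    _ ≤ 4 := by rw [norm_one]; linarith

lemma measurable_defect_tilt (a δ : ℝ) : Measurable fun w => defect (tilt a δ w) w := by
  unfold defect
  have := measurable_p
  have := measurable_tilt a δ
  fun_prop

lemma integrable_defect_tilt (him : (mult a δ).im ≠ 0)
    (hB : ‖mult a δ - 1‖ * (2 * ‖mult a δ‖ / |(mult a δ).im|) ≤ 3) :
    Integrable (fun w => defect (tilt a δ w) w) nu :=
  integrable_of_norm_le (measurable_defect_tilt a δ).aestronglyMeasurable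
    (norm_defect_tilt_le him hB)

lemma ae_ne_zero_nu : ∀ᵐ w ∂nu, w ≠ 0 := by
  rw [nu_eq_withDensity]
  exact (withDensity_absolutelyContinuous _ _).ae_le ae_ne_zero_pi

lemma exp_eq_tilt (a δ w : ℝ) :
    Complex.exp (a * g w * Complex.I) = Complex.exp (-δ) * tilt a δ w := by
  rw [tilt, ← Complex.exp_add]; congr 1; ring

lemma norm_exp_mul_I (x y : ℝ) : ‖Complex.exp (x * y * Complex.I)‖ = 1 := by
  rw [← Complex.ofReal_mul, Complex.norm_exp_ofReal_mul_I]

lemma measurable_exp_g (a : ℝ) : Measurable fun w : ℝ => Complex.exp (a * g w * Complex.I) := by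
  have := measurable_g
  fun_prop

/-- Holding contributes `exp (-δ) p b ψ`, which is `exp (-δ) (ψ - (1 - p))` by the definition of
`ψ`. Jumping contributes `exp (-δ) (1 - p) (1 + D)`, since `b ψ = 1 + (b - 1) / (1 - p b)`. The two
terms `1 - p` cancel, so `ψ` is an exact eigenfunction when `D = 0`. -/
lemma integral_tilted_Q (him : (mult a δ).im ≠ 0)
    (hB : ‖mult a δ - 1‖ * (2 * ‖mult a δ‖ / |(mult a δ).im|) ≤ 3) (w : ℝ) :
    ∫ z, Complex.exp (a * g z * Complex.I) * eigenfn a δ z ∂Q w =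
      Complex.exp (-δ) * (eigenfn a δ w + (1 - p w) * ∫ z, defect (tilt a δ z) z ∂nu) := by
  have hm : Measurable fun z => Complex.exp (a * g z * Complex.I) * eigenfn a δ z :=
    (measurable_exp_g a).mul (measurable_eigenfn a δ)
  have hb : ∀ z, ‖Complex.exp (a * g z * Complex.I) * eigenfn a δ z‖ ≤ 4 := fun z => by
    rw [norm_mul, norm_exp_mul_I, one_mul]
    exact norm_eigenfn_le him hB z
  have hnu : ∫ z, Complex.exp (a * g z * Complex.I) * eigenfn a δ z ∂nu =
      Complex.exp (-δ) * (1 + ∫ z, defect (tilt a δ z) z ∂nu) := by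
    have h1 : (1 : ℂ) + ∫ z, defect (tilt a δ z) z ∂nu =
        ∫ z, (1 + defect (tilt a δ z) z) ∂nu := by
      rw [integral_add (integrable_const _) (integrable_defect_tilt him hB)]
      simp
    rw [h1, ← integral_const_mul]
    refine integral_congr_ae ?_
    filter_upwards [ae_ne_zero_nu] with z hz
    have h := one_sub_mul_ne_zero (tilt_im_ne_zero him hz) (p z)
    rw [exp_eq_tilt a δ, eigenfn, defect, mul_assoc, ← mul_div_assoc]
    congr 1
    rw [eq_comm, add_comm, div_add_one h]
    congr 1
    ring
  rw [integral_Q hm.stronglyMeasurable (integrable_of_norm_le hm.aestronglyMeasurable hb), hnu,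
    exp_eq_tilt a δ]
  have h := eigenfn_mul him w
  simp only [Complex.real_smul]
  push_cast
  linear_combination (-Complex.exp (-(δ : ℂ))) * h

/-- The tilted sum `exp (i a S_n) ψ(W_n)` has nearly geometric expectation. -/
lemma norm_integral_eigenfn_sub_le (hδ : 0 ≤ δ) (him : (mult a δ).im ≠ 0)
    (hB : ‖mult a δ - 1‖ * (2 * ‖mult a δ‖ / |(mult a δ).im|) ≤ 3) (w : ℝ) (n : ℕ) :
    ‖∫ y, Complex.exp (a * y.1 * Complex.I) * eigenfn a δ y.2 ∂sumState n w -
      Complex.exp (-δ) ^ n * eigenfn a δ w‖ ≤ n * ‖∫ z, defect (tilt a δ z) z ∂nu‖ := by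
  set D := ∫ z, defect (tilt a δ z) z ∂nu
  have hmeas : Measurable fun y : ℝ × ℝ =>
      Complex.exp (a * y.1 * Complex.I) * eigenfn a δ y.2 := by
    have := measurable_eigenfn a δ
    fun_prop
  have hbd : ∀ y : ℝ × ℝ, ‖Complex.exp (a * y.1 * Complex.I) * eigenfn a δ y.2‖ ≤ 4 := fun y => by
    rw [norm_mul, norm_exp_mul_I, one_mul]
    exact norm_eigenfn_le him hB _
  have hexp : ‖Complex.exp (-(δ : ℂ))‖ ≤ 1 := by
    rw [Complex.norm_exp]
    simpa using hδ
  induction n with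
  | zero =>
    rw [sumState, Kernel.deterministic_apply, integral_dirac' _ _ hmeas.stronglyMeasurable]
    simp
  | succ n ih =>
    rw [integral_sumState_succ n w hmeas hbd]
    have hstep : ∀ y : ℝ × ℝ, ∫ z, Complex.exp (a * ((y.1 + g z : ℝ) : ℂ) * Complex.I) *
        eigenfn a δ z ∂Q y.2 = Complex.exp (-δ) * (Complex.exp (a * y.1 * Complex.I) *
          eigenfn a δ y.2) + Complex.exp (-δ) * (Complex.exp (a * y.1 * Complex.I) *
          ((1 - p y.2) * D)) := fun y => by
      have h1 : ∀ z, Complex.exp (a * ((y.1 + g z : ℝ) : ℂ) * Complex.I) * eigenfn a δ z =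
          Complex.exp (a * y.1 * Complex.I) *
            (Complex.exp (a * g z * Complex.I) * eigenfn a δ z) := fun z => by
        rw [← mul_assoc, ← Complex.exp_add]
        congr 2
        push_cast
        ring
      simp only [h1]
      rw [integral_const_mul, integral_tilted_Q him hB]
      ring
    have hmeas2 : Measurable fun y : ℝ × ℝ =>
        Complex.exp (a * y.1 * Complex.I) * ((1 - p y.2) * D) := by
      have := measurable_p
      fun_prop
    have hbd2 : ∀ y : ℝ × ℝ, ‖Complex.exp (a * y.1 * Complex.I) * ((1 - p y.2) * D)‖ ≤ ‖D‖ :=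
      fun y => by
        rw [norm_mul, norm_exp_mul_I, one_mul, norm_mul, ← Complex.ofReal_one,
          ← Complex.ofReal_sub, Complex.norm_real,
          Real.norm_of_nonneg (sub_nonneg.2 (p_le_one _))]
        nlinarith [norm_nonneg D, p_pos y.2]
    simp only [hstep]
    rw [integral_add ((integrable_of_norm_le hmeas.aestronglyMeasurable hbd).const_mul _)
      ((integrable_of_norm_le hmeas2.aestronglyMeasurable hbd2).const_mul _),
      integral_const_mul, integral_const_mul]
    have hI2 : ‖∫ y, Complex.exp (a * y.1 * Complex.I) * ((1 - p y.2) * D) ∂sumState n w‖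
        ≤ ‖D‖ := by
      simpa using norm_integral_le_of_norm_le_const (μ := sumState n w) (ae_of_all _ hbd2)
    set I1 := ∫ y, Complex.exp (a * y.1 * Complex.I) * eigenfn a δ y.2 ∂sumState n w
    set I2 := ∫ y, Complex.exp (a * y.1 * Complex.I) * ((1 - p y.2) * D) ∂sumState n w
    -- Each step adds one error of norm at most `‖D‖`, and `‖exp (-δ)‖ ≤ 1` keeps earlier errors
    -- from growing.
    have e : Complex.exp (-δ) * I1 + Complex.exp (-δ) * I2 -
        Complex.exp (-δ) ^ (n + 1) * eigenfn a δ w =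
        Complex.exp (-δ) * ((I1 - Complex.exp (-δ) ^ n * eigenfn a δ w) + I2) := by ring
    rw [e, norm_mul]
    calc _ ≤ 1 * ‖(I1 - Complex.exp (-δ) ^ n * eigenfn a δ w) + I2‖ := by gcongr
      _ ≤ 1 * (n * ‖D‖ + ‖D‖) := by
          gcongr
          exact (norm_add_le _ _).trans (add_le_add ih hI2)
      _ = ((n + 1 : ℕ) : ℝ) * ‖D‖ := by push_cast; ring

end Tilted

/-! ### Convergence of the conditional characteristic functions -/

section Limit

variable {a : ℕ → ℝ} {s : ℝ}

/-- This is where the relation between frequency and decay rate is fixed: the linear part gives `2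
s`, and each of the two logarithmic parts removes `s`. -/
lemma tendsto_nat_mul_defect (hs : 0 < s)
    (h : Tendsto (fun n : ℕ => a n ^ 2 * (n * Real.log n)) atTop (𝓝 (2 * s))) :
    Tendsto (fun n : ℕ => n * ‖∫ z, defect (tilt (a n) (s / n) z) z ∂nu‖) atTop (𝓝 0) := by
  have h' : Tendsto (fun n : ℕ => (-a n) ^ 2 * (n * Real.log n)) atTop (𝓝 (2 * s)) := by
    simpa using h
  have h1 := ((tendsto_nat_mul_mult_add hs h).sub ((tendsto_nat_mul_log_part hs h).add
    (tendsto_nat_mul_log_part hs h'))).const_mul ((Real.exp 1 / 2 : ℝ) : ℂ)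
  have e : ((Real.exp 1 / 2 : ℝ) : ℂ) * (2 * s - (s + s)) = 0 := by ring
  rw [e] at h1
  have h2 := h1.norm
  rw [norm_zero] at h2
  refine h2.congr' ?_
  filter_upwards [eventually_mult_im_ne_zero hs h, eventually_mult_im_ne_zero hs h',
    eventually_bound_le_three hs h] with n hn hn' hB
  rw [integral_defect_nu hn hn' (integrable_defect_tilt hn hB)]
  rw [← Complex.norm_natCast, ← norm_mul]
  congr 1
  ring

lemma tendsto_eigenfn_sub_one
    (h : Tendsto (fun n : ℕ => a n ^ 2 * (n * Real.log n)) atTop (𝓝 (2 * s))) {w : ℝ}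
    (hw : w ≠ 0) :
    Tendsto (fun n : ℕ => ‖eigenfn (a n) (s / n) w - 1‖) atTop (𝓝 0) := by
  have h' : Tendsto (fun n : ℕ => (-a n) ^ 2 * (n * Real.log n)) atTop (𝓝 (2 * s)) := by
    simpa using h
  have ht : Tendsto (fun n : ℕ => tilt (a n) (s / n) w) atTop (𝓝 1) := by
    rcases Real.sign_apply_eq_of_ne_zero w hw with hg | hg
    · refine (tendsto_mult h').congr fun n => ?_
      simp [tilt, mult, g, hg]
    · refine (tendsto_mult h).congr fun n => ?_
      simp [tilt, mult, g, hg]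
  have hne : (1 : ℂ) - p w * 1 ≠ 0 := by
    rw [mul_one]
    exact_mod_cast (sub_pos.2 (p_lt_one hw)).ne'
  have h1 : Tendsto (fun n : ℕ => eigenfn (a n) (s / n) w) atTop
      (𝓝 ((1 - p w) / (1 - p w * 1))) :=
    tendsto_const_nhds.div ((ht.const_mul _).const_sub 1) hne
  rw [mul_one] at hne
  rw [mul_one, div_self hne] at h1
  simpa using (h1.sub_const 1).norm

/-- Pointwise convergence of the conditional characteristic functions of the partial sums. -/
lemma tendsto_integral_exp_sumState (hs : 0 < s)
    (h : Tendsto (fun n : ℕ => a n ^ 2 * (n * Real.log n)) atTop (𝓝 (2 * s))) {w : ℝ}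
    (hw : w ≠ 0) :
    Tendsto (fun n : ℕ => ∫ y, Complex.exp (a n * y.1 * Complex.I) ∂sumState n w) atTop
      (𝓝 (Complex.exp (-s))) := by
  set f : ℕ → ℝ → ENNReal := fun n x => ‖eigenfn (a n) (s / n) x - 1‖ₑ with hf
  have hfm : ∀ n, Measurable (f n) := fun n => ((measurable_eigenfn _ _).sub_const 1).enorm
  have hev : ∀ᶠ n : ℕ in atTop, ∀ x, f n x ≤ 3 := by
    filter_upwards [eventually_mult_im_ne_zero hs h, eventually_bound_le_three hs h] with n hn hB x
    have := norm_eigenfn_sub_one_le hn hB x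
    rw [hf]
    simp only
    rw [← ofReal_norm]
    exact (ENNReal.ofReal_le_ofReal this).trans (by norm_num)
  have hpt : ∀ x : ℝ, x ≠ 0 → Tendsto (fun n => f n x) atTop (𝓝 0) := fun x hx => by
    have := ENNReal.tendsto_ofReal (tendsto_eigenfn_sub_one h hx)
    simp only [ofReal_norm, ENNReal.ofReal_zero] at this
    exact this
  have hpi : Tendsto (fun n => ∫⁻ x, f n x ∂pi) atTop (𝓝 0) := by
    have := tendsto_lintegral_filter_of_dominated_convergence (μ := pi) (F := f) (f := 0)
      (l := atTop) (fun _ => 3) (Eventually.of_forall hfm)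
      (hev.mono fun n hn => ae_of_all _ hn) (by simp)
      (by filter_upwards [ae_ne_zero_pi] with x hx using hpt x hx)
    simpa using this
  -- The law of `W_n` varies with `n`, but its domination by the point mass at `w` plus `e pi`
  -- reduces the claim to convergence at `w` and in `pi`-mean.
  have hJ : Tendsto (fun n => ∫⁻ y, f n y.2 ∂sumState n w) atTop (𝓝 0) := by
    refine tendsto_of_tendsto_of_tendsto_of_le_of_le tendsto_const_nhds ?_ (fun _ => zero_le)
      fun n => lintegral_sumState_le_add n w (hfm n)
    simpa using (hpt w hw).add (ENNReal.Tendsto.const_mul hpi (Or.inr (by simp)))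
  have hJ' := (ENNReal.tendsto_toReal ENNReal.zero_ne_top).comp hJ
  have hsum := (hJ'.add (tendsto_nat_mul_defect hs h)).add (tendsto_eigenfn_sub_one h hw)
  rw [ENNReal.toReal_zero, add_zero, add_zero] at hsum
  rw [tendsto_iff_norm_sub_tendsto_zero]
  refine squeeze_zero' (Eventually.of_forall fun _ => norm_nonneg _) ?_ hsum
  filter_upwards [eventually_mult_im_ne_zero hs h, eventually_bound_le_three hs h,
    eventually_gt_atTop 0] with n hn hB hn0
  have hn1 : (n : ℝ) ≠ 0 := by exact_mod_cast hn0.ne'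
  have hδ : 0 ≤ s / n := by positivity
  -- The choice `δ = s / n` makes the `n`-th power of the approximate eigenvalue independent of `n`.
  have hpow : Complex.exp (-((s / n : ℝ) : ℂ)) ^ n = Complex.exp (-s) := by
    rw [← Complex.exp_nat_mul]
    congr 1
    have : (n : ℂ) ≠ 0 := by exact_mod_cast hn0.ne'
    push_cast
    field_simp
  have key := norm_integral_eigenfn_sub_le hδ hn hB w n
  rw [hpow] at key
  have hm1 : Measurable fun y : ℝ × ℝ => Complex.exp (a n * y.1 * Complex.I) := by fun_prop
  have hm2 : Measurable fun y : ℝ × ℝ =>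
      Complex.exp (a n * y.1 * Complex.I) * eigenfn (a n) (s / n) y.2 := by
    have := measurable_eigenfn (a n) (s / n)
    fun_prop
  have hi1 : Integrable (fun y : ℝ × ℝ => Complex.exp (a n * y.1 * Complex.I)) (sumState n w) :=
    integrable_of_norm_le hm1.aestronglyMeasurable fun y => (norm_exp_mul_I _ _).le
  have hi2 : Integrable (fun y : ℝ × ℝ =>
      Complex.exp (a n * y.1 * Complex.I) * eigenfn (a n) (s / n) y.2) (sumState n w) :=
    integrable_of_norm_le hm2.aestronglyMeasurable (C := 4) fun y => by
      rw [norm_mul, norm_exp_mul_I, one_mul]; exact norm_eigenfn_le hn hB _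
  have hdiff : ‖(∫ y, Complex.exp (a n * y.1 * Complex.I) ∂sumState n w) -
      ∫ y, Complex.exp (a n * y.1 * Complex.I) * eigenfn (a n) (s / n) y.2 ∂sumState n w‖ ≤
      (∫⁻ y, f n y.2 ∂sumState n w).toReal := by
    rw [← integral_sub hi1 hi2]
    refine (norm_integral_le_lintegral_norm _).trans (le_of_eq ?_)
    congr 1
    refine lintegral_congr fun y => ?_
    rw [← mul_one_sub, norm_mul, norm_exp_mul_I, one_mul, norm_sub_rev, hf, ofReal_norm]
  set A := ∫ y, Complex.exp (a n * y.1 * Complex.I) ∂sumState n w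
  set B := ∫ y, Complex.exp (a n * y.1 * Complex.I) * eigenfn (a n) (s / n) y.2 ∂sumState n w
  have hlast : ‖Complex.exp (-(s : ℂ)) * eigenfn (a n) (s / n) w - Complex.exp (-(s : ℂ))‖ ≤
      ‖eigenfn (a n) (s / n) w - 1‖ := by
    rw [← mul_sub_one, norm_mul]
    refine mul_le_of_le_one_left (norm_nonneg _) ?_
    rw [Complex.norm_exp]
    simpa using hs.le
  -- Three errors: inserting `ψ(W_n)`, the accumulated defect, and removing `ψ(w)`.
  calc ‖A - Complex.exp (-s)‖ = ‖(A - B) + (B - Complex.exp (-s) * eigenfn (a n) (s / n) w) +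
        (Complex.exp (-s) * eigenfn (a n) (s / n) w - Complex.exp (-s))‖ := by congr 1; ring
    _ ≤ _ := norm_add₃_le
    _ ≤ _ := add_le_add (add_le_add hdiff key) hlast

end Limit


/-! ### Joint laws along an arbitrary stationary chain -/

lemma measurable_S {Ω : Type*} {m : MeasurableSpace Ω} {W : ℤ → Ω → ℝ} {n : ℕ}
    (h : ∀ k : ℤ, k ≤ n → Measurable (W k)) : Measurable (S W n) := by
  unfold S
  refine Finset.measurable_fun_sum _ fun k hk => measurable_g.comp (h k ?_)
  exact_mod_cast (Finset.mem_Icc.1 hk).2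

lemma S_zero {Ω : Type*} (W : ℤ → Ω → ℝ) (ω : Ω) : S W 0 ω = 0 := by simp [S]

lemma S_succ {Ω : Type*} (W : ℤ → Ω → ℝ) (n : ℕ) (ω : Ω) :
    S W (n + 1) ω = S W n ω + g (W ((n : ℤ) + 1) ω) := by
  rw [S, Finset.sum_Icc_succ_top (by omega)]
  rfl

lemma abs_S_le {Ω : Type*} (W : ℤ → Ω → ℝ) (n : ℕ) (ω : Ω) : |S W n ω| ≤ n := by
  induction n with
  | zero => simp [S_zero]
  | succ n ih =>
    rw [S_succ]
    push_cast
    exact (abs_add_le _ _).trans (add_le_add ih (abs_g_le_one _))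

/-- The `σ`-algebra of the past up to time `n`. -/
abbrev past {Ω : Type*} (W : ℤ → Ω → ℝ) (n : ℤ) : MeasurableSpace Ω :=
  ⨆ (k : ℤ) (_ : k ≤ n), MeasurableSpace.comap (W k) inferInstance

lemma measurable_past {Ω : Type*} {W : ℤ → Ω → ℝ} {n k : ℤ} (hk : k ≤ n) : Measurable[past W n] (W k) :=
  (comap_measurable (W k)).mono (le_iSup₂ (f := fun (k : ℤ) (_ : k ≤ n) =>
    MeasurableSpace.comap (W k) inferInstance) k hk) le_rfl

lemma measurable_past_S {Ω : Type*} {W : ℤ → Ω → ℝ} (n : ℕ) : Measurable[past W n] (S W n) :=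
  measurable_S fun _ hk => measurable_past hk

section Chain

variable {Ω : Type*} [mΩ : MeasurableSpace Ω] {P : Measure Ω} {W : ℤ → Ω → ℝ}

lemma past_le (hW : ∀ n, Measurable (W n)) (n : ℤ) : past W n ≤ mΩ :=
  iSup₂_le fun k _ => (hW k).comap_le

lemma IsStationaryMarkovChain.integral_comp (hW : IsStationaryMarkovChain P Q pi W) (n : ℤ)
    {f : ℝ → ℝ} (hf : Measurable f) : ∫ ω, f (W n ω) ∂P = ∫ w, f w ∂pi := by
  rw [← hW.marginal n, integral_map (hW.measurable n).aemeasurable hf.aestronglyMeasurable]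

lemma IsStationaryMarkovChain.ae_ne_zero (hW : IsStationaryMarkovChain P Q pi W) (n : ℤ) :
    ∀ᵐ ω ∂P, W n ω ≠ 0 := by
  have := ae_ne_zero_pi
  rw [← hW.marginal n] at this
  exact ae_of_ae_map (hW.measurable n).aemeasurable this

lemma IsStationaryMarkovChain.measurable_sum (hW : IsStationaryMarkovChain P Q pi W) (n : ℕ) :
    Measurable (S W n) := measurable_S fun k _ => hW.measurable k

variable [IsProbabilityMeasure P]

/-- The Markov property, for joint laws with a function of the past. -/
lemma IsStationaryMarkovChain.map_prodMk (hW : IsStationaryMarkovChain P Q pi W) {α : Type*}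
    [MeasurableSpace α] {n : ℤ} {Y : Ω → α} (hY : Measurable[past W n] Y) {q : α → ℝ}
    (hq : Measurable q) (hqY : ∀ ω, q (Y ω) = W n ω) :
    P.map (fun ω => (Y ω, W (n + 1) ω)) = (P.map Y) ⊗ₘ (Q.comap q hq) := by
  have hle := past_le hW.measurable n
  have hYm : Measurable Y := hY.mono hle le_rfl
  have : IsProbabilityMeasure (P.map Y) := Measure.isProbabilityMeasure_map hYm.aemeasurable
  have : IsProbabilityMeasure (P.map (fun ω => (Y ω, W (n + 1) ω))) :=
    Measure.isProbabilityMeasure_map (hYm.prodMk (hW.measurable _)).aemeasurable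
  refine Measure.ext_prod fun {A B} hA hB => ?_
  have hmW : MeasurableSet (W (n + 1) ⁻¹' B) := hW.measurable _ hB
  rw [Measure.map_apply (hYm.prodMk (hW.measurable _)) (hA.prod hB),
    Measure.compProd_apply_prod hA hB,
    setLIntegral_map hA (Kernel.measurable_coe _ hB) hYm]
  have h1 : ∫ ω in Y ⁻¹' A, (W (n + 1) ⁻¹' B).indicator (fun _ => (1 : ℝ)) ω ∂P =
      ∫ ω in Y ⁻¹' A, (Q (W n ω)).real B ∂P := by
    rw [← setIntegral_condExp hle ((integrable_const _).indicator hmW) (hY hA)]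
    exact setIntegral_congr_ae (hle _ (hY hA)) ((hW.markov n B hB).mono fun ω h _ => h)
  rw [setIntegral_indicator hmW, setIntegral_const, smul_eq_mul, mul_one] at h1
  have h2 : Measurable fun ω => Q (W n ω) B := (Kernel.measurable_coe Q hB).comp (hW.measurable n)
  have h3 : ∫ ω in Y ⁻¹' A, (Q (W n ω)).real B ∂P =
      (∫⁻ ω in Y ⁻¹' A, Q (W n ω) B ∂P).toReal :=
    integral_toReal h2.aemeasurable (ae_of_all _ fun ω => measure_lt_top _ _)
  rw [h3] at h1
  have h4 : ∫⁻ ω in Y ⁻¹' A, Q (W n ω) B ∂P ≠ ⊤ := by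
    refine ne_top_of_le_ne_top (b := P (Y ⁻¹' A)) (measure_ne_top _ _) ?_
    calc ∫⁻ ω in Y ⁻¹' A, Q (W n ω) B ∂P ≤ ∫⁻ ω in Y ⁻¹' A, 1 ∂P :=
          lintegral_mono fun ω => prob_le_one
      _ = P (Y ⁻¹' A) := by simp
  have h5 := (ENNReal.toReal_eq_toReal_iff' (measure_ne_top _ _) h4).1 h1
  simp only [Kernel.comap_apply, hqY]
  rw [← h5]
  rfl

lemma IsStationaryMarkovChain.integral_next (hW : IsStationaryMarkovChain P Q pi W) {α : Type*}
    [MeasurableSpace α] {n : ℤ} {Y : Ω → α} (hY : Measurable[past W n] Y) {q : α → ℝ}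
    (hq : Measurable q) (hqY : ∀ ω, q (Y ω) = W n ω) {f : α × ℝ → ℝ} (hf : Measurable f) {C : ℝ}
    (hC : ∀ ω z, |f (Y ω, z)| ≤ C) :
    ∫ ω, f (Y ω, W (n + 1) ω) ∂P = ∫ ω, ∫ z, f (Y ω, z) ∂Q (W n ω) ∂P := by
  have hYm : Measurable Y := hY.mono (past_le hW.measurable n) le_rfl
  have hmap := hW.map_prodMk hY hq hqY
  have hm := hYm.prodMk (hW.measurable (n + 1))
  have : IsProbabilityMeasure (P.map Y) := Measure.isProbabilityMeasure_map hYm.aemeasurable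
  have hint : Integrable f ((P.map Y) ⊗ₘ (Q.comap q hq)) := by
    rw [← hmap, integrable_map_measure hf.aestronglyMeasurable hm.aemeasurable]
    exact integrable_of_norm_le (hf.comp hm).aestronglyMeasurable fun ω => hC ω _
  rw [← integral_map (φ := fun ω => (Y ω, W (n + 1) ω)) hm.aemeasurable hf.aestronglyMeasurable,
    hmap, Measure.integral_compProd hint, integral_map hYm.aemeasurable]
  · simp only [Kernel.comap_apply, hqY]
  · exact (hf.stronglyMeasurable.integral_kernel_prod_right'
      (κ := Q.comap q hq)).aestronglyMeasurable

/-- The joint law of `W_0` and `(S_n, W_n)`. -/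
lemma IsStationaryMarkovChain.map_sumState (hW : IsStationaryMarkovChain P Q pi W) (n : ℕ) :
    P.map (fun ω => (W 0 ω, (S W n ω, W n ω))) = pi ⊗ₘ sumState n := by
  induction n with
  | zero =>
    rw [sumState, Measure.compProd_deterministic, ← hW.marginal 0,
      Measure.map_map (by fun_prop) (hW.measurable 0)]
    simp only [S_zero]
    rfl
  | succ n ih =>
    have hY : Measurable[past W n] fun ω => (W 0 ω, (S W n ω, W n ω)) :=
      (measurable_past (by positivity)).prodMk ((measurable_past_S n).prodMk
        (measurable_past le_rfl))
    have hYm := hY.mono (past_le hW.measurable n) le_rfl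
    have hmap := hW.map_prodMk hY (q := fun y : ℝ × ℝ × ℝ => y.2.2) (by fun_prop) fun _ => rfl
    rw [ih] at hmap
    have hφ : Measurable fun y : (ℝ × ℝ × ℝ) × ℝ => (y.1.1, (y.1.2.1 + g y.2, y.2)) := by
      have := measurable_g
      fun_prop
    have e : (fun ω => (W 0 ω, (S W (n + 1) ω, W ((n + 1 : ℕ) : ℤ) ω))) =
        (fun y : (ℝ × ℝ × ℝ) × ℝ => (y.1.1, (y.1.2.1 + g y.2, y.2))) ∘
          fun ω => ((W 0 ω, (S W n ω, W n ω)), W ((n : ℤ) + 1) ω) := by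
      ext ω <;> simp [S_succ]
    rw [e, ← Measure.map_map hφ (hYm.prodMk (hW.measurable _)), hmap]
    refine Measure.ext_of_lintegral _ fun f hf => ?_
    have hfφ : Measurable fun y : (ℝ × ℝ × ℝ) × ℝ => f (y.1.1, (y.1.2.1 + g y.2, y.2)) :=
      hf.comp hφ
    rw [lintegral_map hf hφ, Measure.lintegral_compProd hfφ,
      Measure.lintegral_compProd hf, Measure.lintegral_compProd]
    · refine lintegral_congr fun w => ?_
      rw [lintegral_sumState_succ n w (f := fun y => f (w, y)) (by fun_prop)]
      rfl
    · exact hfφ.lintegral_kernel_prod_right'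

/-! ### The exact second moment of the partial sums -/

/-- The jump part integrates an odd function against the symmetric `nu` and vanishes, so `Q` acts on
this family as multiplication by `p`. -/
lemma integral_p_pow_mul_g_Q (m : ℕ) (w : ℝ) :
    ∫ z, p z ^ m * g z ∂Q w = p w ^ (m + 1) * g w := by
  have hm : Measurable fun z => p z ^ m * g z := (measurable_p.pow_const m).mul measurable_g
  rw [integral_Q hm.stronglyMeasurable, integral_nu_eq_zero_of_odd]
  · simp [pow_succ]; ring
  · intro w; rw [p_neg, g_neg]; ring
  · refine integrable_of_norm_le hm.aestronglyMeasurable (C := 1) fun w => ?_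
    rw [norm_mul, norm_pow, Real.norm_of_nonneg (p_pos w).le]
    exact mul_le_one₀ (pow_le_one₀ (p_pos w).le (p_le_one w)) (norm_nonneg _) (abs_g_le_one w)

lemma abs_p_pow_mul_g_le (m : ℕ) (z : ℝ) : |p z ^ m * g z| ≤ 1 := by
  rw [abs_mul, abs_of_nonneg (pow_nonneg (p_pos z).le m)]
  exact mul_le_one₀ (pow_le_one₀ (p_pos z).le (p_le_one z)) (abs_nonneg _) (abs_g_le_one z)

lemma IsStationaryMarkovChain.integrable_S_mul (hW : IsStationaryMarkovChain P Q pi W) (n : ℕ)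
    {f : Ω → ℝ} (hf : Measurable f) (hf1 : ∀ ω, |f ω| ≤ 1) :
    Integrable (fun ω => S W n ω * f ω) P := by
  refine integrable_of_norm_le ((hW.measurable_sum n).mul hf).aestronglyMeasurable (C := n * 1)
    fun ω => ?_
  rw [norm_mul]
  exact mul_le_mul (abs_S_le W n ω) (hf1 ω) (abs_nonneg _) (Nat.cast_nonneg n)

/-- Correlation of `S_n` with functions of the next state. -/
lemma IsStationaryMarkovChain.integral_S_mul (hW : IsStationaryMarkovChain P Q pi W) (n m : ℕ) :
    ∫ ω, S W n ω * (p (W ((n : ℤ) + 1) ω) ^ m * g (W ((n : ℤ) + 1) ω)) ∂P =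
      ∑ k ∈ Finset.range n, ∫ w, p w ^ (m + k + 1) ∂pi := by
  have hpg : ∀ m, Measurable fun z => p z ^ m * g z :=
    fun m => (measurable_p.pow_const m).mul measurable_g
  -- Conditioning on the past trades one time step for one more power of `p`.
  have hstep : ∀ n m : ℕ,
      ∫ ω, S W n ω * (p (W ((n : ℤ) + 1) ω) ^ m * g (W ((n : ℤ) + 1) ω)) ∂P =
      ∫ ω, S W n ω * (p (W n ω) ^ (m + 1) * g (W n ω)) ∂P := fun n m => by
    have h := hW.integral_next (n := n) (Y := fun ω => (S W n ω, W n ω))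
      ((measurable_past_S n).prodMk (measurable_past le_rfl)) (q := Prod.snd) measurable_snd
      (fun _ => rfl) (f := fun y => y.1.1 * (p y.2 ^ m * g y.2))
      (measurable_fst.fst.mul ((hpg m).comp measurable_snd)) (C := n * 1) (fun ω z => by
        rw [abs_mul]
        exact mul_le_mul (abs_S_le W n ω) (abs_p_pow_mul_g_le m z) (abs_nonneg _)
          (Nat.cast_nonneg n))
    rw [h]
    refine integral_congr_ae (ae_of_all _ fun ω => ?_)
    simp only
    rw [integral_const_mul, integral_p_pow_mul_g_Q]
  induction n generalizing m with
  | zero => simp [S_zero]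
  | succ n ih =>
    rw [hstep]
    -- Splitting off the last summand, `g² = 1` leaves a pure power of `p`, whose mean is explicit
    -- by stationarity.
    have e : ∀ᵐ ω ∂P, S W (n + 1) ω *
        (p (W ((n + 1 : ℕ) : ℤ) ω) ^ (m + 1) * g (W ((n + 1 : ℕ) : ℤ) ω)) =
        S W n ω * (p (W ((n : ℤ) + 1) ω) ^ (m + 1) * g (W ((n : ℤ) + 1) ω)) +
          p (W ((n : ℤ) + 1) ω) ^ (m + 1) := by
      filter_upwards [hW.ae_ne_zero ((n : ℤ) + 1)] with ω hω
      rw [S_succ]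
      push_cast
      have := g_sq hω
      linear_combination p (W ((n : ℤ) + 1) ω) ^ (m + 1) * this
    have hpm : Measurable fun z => p z ^ (m + 1) := measurable_p.pow_const _
    have h1 : Integrable (fun ω => S W n ω *
        (p (W ((n : ℤ) + 1) ω) ^ (m + 1) * g (W ((n : ℤ) + 1) ω))) P :=
      hW.integrable_S_mul n ((hpg _).comp (hW.measurable _)) fun ω => abs_p_pow_mul_g_le _ _
    have h2 : Integrable (fun ω => p (W ((n : ℤ) + 1) ω) ^ (m + 1)) P :=
      integrable_of_norm_le (hpm.comp (hW.measurable _)).aestronglyMeasurable (C := 1) fun ω => by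
        rw [norm_pow, Real.norm_of_nonneg (p_pos _).le]
        exact pow_le_one₀ (p_pos _).le (p_le_one _)
    rw [integral_congr_ae e, integral_add h1 h2, ih, hW.integral_comp _ hpm, Finset.sum_range_succ']
    congr 1
    refine Finset.sum_congr rfl fun k _ => ?_
    rw [show m + 1 + k + 1 = m + (k + 1) + 1 by ring]

lemma IsStationaryMarkovChain.integral_S_sq (hW : IsStationaryMarkovChain P Q pi W) (n : ℕ) :
    ∫ ω, S W n ω ^ 2 ∂P = ∑ j ∈ Finset.range n,
      (1 + 2 * ∑ k ∈ Finset.range j, (1 - Real.exp (-((k + 1 : ℕ) : ℝ))) / ((k + 1 : ℕ) : ℝ)) := by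
  induction n with
  | zero => simp [S_zero]
  | succ n ih =>
    have hsq : Integrable (fun ω => S W n ω ^ 2) P := by
      refine integrable_of_norm_le ((hW.measurable_sum n).pow_const 2).aestronglyMeasurable
        (C := (n : ℝ) ^ 2) fun ω => ?_
      rw [norm_pow]
      exact pow_le_pow_left₀ (norm_nonneg _) (abs_S_le W n ω) 2
    have hg : Measurable fun ω => g (W ((n : ℤ) + 1) ω) := measurable_g.comp (hW.measurable _)
    have hcross := hW.integrable_S_mul n hg fun ω => abs_g_le_one _
    have e : ∀ᵐ ω ∂P, S W (n + 1) ω ^ 2 =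
        (S W n ω ^ 2 + 2 * (S W n ω * g (W ((n : ℤ) + 1) ω))) + 1 := by
      filter_upwards [hW.ae_ne_zero ((n : ℤ) + 1)] with ω hω
      rw [S_succ]
      linear_combination g_sq hω
    have hC := hW.integral_S_mul n 0
    simp only [pow_zero, one_mul, zero_add] at hC
    have hadd : Integrable (fun ω => S W n ω ^ 2 +
        2 * (S W n ω * g (W ((n : ℤ) + 1) ω))) P := hsq.add (hcross.const_mul 2)
    rw [integral_congr_ae e, integral_add hadd (integrable_const _),
      integral_add hsq (hcross.const_mul 2), integral_const_mul, hC, ih, Finset.sum_range_succ]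
    simp only [integral_p_pow (Nat.succ_ne_zero _)]
    simp
    ring

end Chain

/-! ### The variance is `2 n log n + O(n)` -/

lemma sum_one_sub_exp_div_le (j : ℕ) :
    ∑ k ∈ Finset.range j, (1 - Real.exp (-((k + 1 : ℕ) : ℝ))) / ((k + 1 : ℕ) : ℝ) ≤
      1 + Real.log j := by
  refine le_trans ?_ (harmonic_le_one_add_log j)
  rw [harmonic]
  push_cast
  refine Finset.sum_le_sum fun k _ => ?_
  rw [inv_eq_one_div]
  gcongr
  linarith [Real.exp_pos (-((k : ℝ) + 1))]

/-- The sum differs from a harmonic number by `∑ exp (-k) / k`, which is at most `∑ 2 ^ (-k) ≤ 1`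
because `e ≥ 2`. -/
lemma le_sum_one_sub_exp_div (j : ℕ) : Real.log (j + 1) - 1 ≤
    ∑ k ∈ Finset.range j, (1 - Real.exp (-((k + 1 : ℕ) : ℝ))) / ((k + 1 : ℕ) : ℝ) := by
  have h := log_add_one_le_harmonic j
  rw [harmonic] at h
  push_cast at h
  have hgeom : ∑ k ∈ Finset.range j, Real.exp (-((k + 1 : ℕ) : ℝ)) ≤ 1 - (1 / 2) ^ j := by
    induction j with
    | zero => simp
    | succ j ih =>
      have hstep : Real.exp (-((j + 1 : ℕ) : ℝ)) ≤ (1 / 2) ^ (j + 1) := by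
        rw [show -((j + 1 : ℕ) : ℝ) = ((j + 1 : ℕ) : ℝ) * (-1) by ring, Real.exp_nat_mul]
        refine pow_le_pow_left₀ (Real.exp_pos _).le ?_ _
        rw [Real.exp_neg, inv_eq_one_div]
        have := Real.add_one_le_exp 1
        gcongr
        linarith
      have ih' := ih (by simpa [harmonic] using log_add_one_le_harmonic j)
      rw [Finset.sum_range_succ]
      rw [pow_succ] at hstep ⊢
      linarith
  have hsub : ∑ k ∈ Finset.range j, ((k : ℝ) + 1)⁻¹ -
      ∑ k ∈ Finset.range j, Real.exp (-((k + 1 : ℕ) : ℝ)) ≤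
      ∑ k ∈ Finset.range j, (1 - Real.exp (-((k + 1 : ℕ) : ℝ))) / ((k + 1 : ℕ) : ℝ) := by
    rw [← Finset.sum_sub_distrib]
    refine Finset.sum_le_sum fun k _ => ?_
    rw [sub_div, one_div]
    push_cast
    gcongr
    refine div_le_self (Real.exp_pos _).le ?_
    linarith [(Nat.cast_nonneg k : (0 : ℝ) ≤ k)]
  have : (0 : ℝ) ≤ (1 / 2) ^ j := by positivity
  push_cast at h hsub hgeom ⊢
  linarith

/-- The right side is `log n!`, and `n ^ n / n! ≤ exp n` is one term of the exponential series. -/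
lemma nat_mul_log_sub_le_sum_log (n : ℕ) :
    (n : ℝ) * Real.log n - n ≤ ∑ j ∈ Finset.range n, Real.log (j + 1) := by
  have hfac : ∑ j ∈ Finset.range n, Real.log (j + 1) = Real.log n.factorial := by
    rw [← Finset.prod_range_add_one_eq_factorial]
    push_cast
    rw [Real.log_prod fun i _ => by positivity]
  rw [hfac]
  rcases Nat.eq_zero_or_pos n with rfl | hn
  · simp
  have hn' : (0 : ℝ) < n := by exact_mod_cast hn
  have h := Real.pow_div_factorial_le_exp (n : ℝ) hn'.le n
  have h2 := Real.log_le_log (by positivity) h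
  rw [Real.log_exp, Real.log_div (by positivity) (by positivity), Real.log_pow] at h2
  linarith

lemma IsStationaryMarkovChain.abs_integral_S_sq_sub_le {Ω : Type*} [MeasurableSpace Ω]
    {P : Measure Ω} [IsProbabilityMeasure P] {W : ℤ → Ω → ℝ}
    (hW : IsStationaryMarkovChain P Q pi W) {n : ℕ} (hn : 0 < n) :
    |∫ ω, S W n ω ^ 2 ∂P - 2 * (n * Real.log n)| ≤ 3 * n := by
  have hn' : (1 : ℝ) ≤ n := by exact_mod_cast hn
  rw [hW.integral_S_sq n]
  have hup : ∑ j ∈ Finset.range n, (1 + 2 * ∑ k ∈ Finset.range j,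
      (1 - Real.exp (-((k + 1 : ℕ) : ℝ))) / ((k + 1 : ℕ) : ℝ)) ≤
      ∑ _j ∈ Finset.range n, (1 + 2 * (1 + Real.log n)) := by
    refine Finset.sum_le_sum fun j hj => ?_
    have h1 := sum_one_sub_exp_div_le j
    have h2 : Real.log j ≤ Real.log n := by
      rcases Nat.eq_zero_or_pos j with rfl | hj0
      · simpa using Real.log_nonneg hn'
      · refine Real.log_le_log (by exact_mod_cast hj0) ?_
        exact_mod_cast (Finset.mem_range.1 hj).le
    linarith
  have hlow : ∑ j ∈ Finset.range n, (1 + 2 * (Real.log (j + 1) - 1)) ≤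
      ∑ j ∈ Finset.range n, (1 + 2 * ∑ k ∈ Finset.range j,
      (1 - Real.exp (-((k + 1 : ℕ) : ℝ))) / ((k + 1 : ℕ) : ℝ)) := by
    refine Finset.sum_le_sum fun j _ => ?_
    have := le_sum_one_sub_exp_div j
    linarith
  rw [Finset.sum_const, Finset.card_range, nsmul_eq_mul] at hup
  have hl : ∑ j ∈ Finset.range n, (1 + 2 * (Real.log ((j : ℝ) + 1) - 1)) =
      2 * ∑ j ∈ Finset.range n, Real.log ((j : ℝ) + 1) - n := by
    rw [Finset.mul_sum, eq_sub_iff_add_eq]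
    have : (n : ℝ) = ∑ _j ∈ Finset.range n, (1 : ℝ) := by simp
    conv_lhs => rw [this]
    rw [← Finset.sum_add_distrib]
    exact Finset.sum_congr rfl fun j _ => by ring
  rw [hl] at hlow
  have := nat_mul_log_sub_le_sum_log n
  -- The upper bound is `n (3 + 2 log n)`, the lower one `2 (n log n - n) - n`; both deviate from `2
  -- n log n` by exactly `3 n`.
  rw [abs_le]
  constructor <;> linarith


/-! ### Tools for weak convergence -/

section Weak

/-- Convergence of first absolute moments under weak convergence and bounded second moments. -/
lemma tendsto_integral_abs_of_tendsto {μ : ℕ → ProbabilityMeasure ℝ} {μ₀ : ProbabilityMeasure ℝ}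
    (h : Tendsto μ atTop (𝓝 μ₀)) {C : ℝ}
    (hint : ∀ᶠ n in atTop, Integrable (fun x => x ^ 2) (μ n : Measure ℝ) ∧
      ∫ x, x ^ 2 ∂(μ n : Measure ℝ) ≤ C)
    (hint₀ : Integrable (fun x => x ^ 2) (μ₀ : Measure ℝ)) (hC₀ : ∫ x, x ^ 2 ∂(μ₀ : Measure ℝ) ≤ C) :
    Tendsto (fun n => ∫ x, |x| ∂(μ n : Measure ℝ)) atTop (𝓝 (∫ x, |x| ∂(μ₀ : Measure ℝ))) := by
  have htrunc : ∀ (ν : ProbabilityMeasure ℝ) (K : ℝ), 0 < K →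
      Integrable (fun x => x ^ 2) (ν : Measure ℝ) → ∫ x, x ^ 2 ∂(ν : Measure ℝ) ≤ C →
      0 ≤ (∫ x, |x| ∂(ν : Measure ℝ)) - ∫ x, min |x| K ∂(ν : Measure ℝ) ∧
      (∫ x, |x| ∂(ν : Measure ℝ)) - ∫ x, min |x| K ∂(ν : Measure ℝ) ≤ C / K := by
    intro ν K hK hν hνC
    have habs : Integrable (fun x : ℝ => |x|) (ν : Measure ℝ) := by
      refine Integrable.mono' (hν.add (integrable_const (1 : ℝ))) (by fun_prop) (ae_of_all _ ?_)
      intro x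
      simp only [Pi.add_apply, Real.norm_eq_abs, abs_abs]
      nlinarith [sq_abs x, sq_nonneg (|x| - 1)]
    have hmin : Integrable (fun x : ℝ => min |x| K) (ν : Measure ℝ) := by
      refine habs.mono' (by fun_prop) (ae_of_all _ fun x => ?_)
      rw [Real.norm_of_nonneg (le_min (abs_nonneg x) hK.le)]
      exact min_le_left _ _
    rw [← integral_sub habs hmin]
    refine ⟨integral_nonneg fun x => sub_nonneg.2 (min_le_left _ _), ?_⟩
    calc ∫ x, (|x| - min |x| K) ∂(ν : Measure ℝ) ≤ ∫ x, x ^ 2 / K ∂(ν : Measure ℝ) := by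
          refine integral_mono (habs.sub hmin) (hν.div_const K) fun x => ?_
          simp only
          rw [le_div_iff₀ hK, ← sq_abs x]
          rcases le_total |x| K with hx | hx
          · rw [min_eq_left hx]; nlinarith [sq_nonneg |x|]
          · rw [min_eq_right hx]; nlinarith [sq_nonneg (|x| - K), abs_nonneg x]
      _ = (∫ x, x ^ 2 ∂(ν : Measure ℝ)) / K := integral_div _ _
      _ ≤ C / K := by gcongr
  have hC : 0 ≤ C := (integral_nonneg fun x => sq_nonneg x).trans hC₀
  rw [Metric.tendsto_atTop']
  intro ε hε
  -- Truncating `|x|` at `K` costs between 0 and `C / K < ε / 2`. Both costs have the same sign, so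
  -- their difference is also below `ε / 2`.
  set K := 2 * (C + 1) / ε
  have hK : 0 < K := by positivity
  have hCK : C / K < ε / 2 := by
    rw [div_lt_iff₀ hK]
    have : ε / 2 * K = C + 1 := by simp only [K]; field_simp
    linarith
  let f : BoundedContinuousFunction ℝ ℝ := BoundedContinuousFunction.ofNormedAddCommGroup
    (fun x : ℝ => min |x| K) (by fun_prop) K fun x => by
      rw [Real.norm_of_nonneg (le_min (abs_nonneg x) hK.le)]
      exact min_le_right _ _
  have hf := (ProbabilityMeasure.tendsto_iff_forall_integral_tendsto.1 h) f
  have hev := (Metric.tendsto_nhds.1 hf (ε / 2) (by positivity)).and hint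
  obtain ⟨N, hN⟩ := eventually_atTop.1 hev
  refine ⟨N, fun n hn => ?_⟩
  obtain ⟨h1, h2, h3⟩ := hN n hn.le
  obtain ⟨h4, h5⟩ := htrunc (μ n) K hK h2 h3
  obtain ⟨h6, h7⟩ := htrunc μ₀ K hK hint₀ hC₀
  rw [Real.dist_eq, abs_lt] at h1 ⊢
  change _ < (∫ x, min |x| K ∂(μ n : Measure ℝ)) - (∫ x, min |x| K ∂(μ₀ : Measure ℝ)) ∧
    (∫ x, min |x| K ∂(μ n : Measure ℝ)) - (∫ x, min |x| K ∂(μ₀ : Measure ℝ)) < _ at h1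
  constructor <;> linarith [h1.1, h1.2]

lemma integral_abs_gaussianReal : ∫ x, |x| ∂gaussianReal 0 (1 / 2) = (√Real.pi)⁻¹ := by
  have hv : (1 / 2 : NNReal) ≠ 0 := by norm_num
  rw [integral_gaussianReal_eq_integral_smul hv]
  -- With variance 1/2 the density is `exp (-x²) / √Real.pi`, and `exp (-y²) y` has an elementary
  -- primitive.
  have hform : ∀ x : ℝ, gaussianPDFReal 0 (1 / 2) x • |x| =
      (fun y : ℝ => (√Real.pi)⁻¹ * (Real.exp (-y ^ 2) * y)) |x| := fun x => by
    rw [gaussianPDFReal]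
    have e1 : 2 * Real.pi * ((1 / 2 : NNReal) : ℝ) = Real.pi := by push_cast; ring
    have e2 : -(x - 0) ^ 2 / (2 * ((1 / 2 : NNReal) : ℝ)) = -|x| ^ 2 := by
      rw [sq_abs]; push_cast; ring
    rw [e1, e2, smul_eq_mul, mul_assoc]
  simp only [hform]
  rw [integral_comp_abs (f := fun y : ℝ => (√Real.pi)⁻¹ * (Real.exp (-y ^ 2) * y)),
    integral_const_mul]
  have hderiv : ∀ x ∈ Set.Ici (0 : ℝ), HasDerivAt (fun x : ℝ => -(1 / 2) * Real.exp (-x ^ 2))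
      (Real.exp (-x ^ 2) * x) x := fun x _ => by
    refine (((hasDerivAt_pow 2 x).neg.exp).const_mul (-(1 / 2) : ℝ)).congr_deriv ?_
    simp
    ring
  have hlim : Tendsto (fun x : ℝ => -(1 / 2) * Real.exp (-x ^ 2)) atTop (𝓝 (-(1 / 2) * 0)) :=
    (Real.tendsto_exp_atBot.comp
      (tendsto_neg_atTop_atBot.comp (tendsto_pow_atTop two_ne_zero))).const_mul _
  rw [integral_Ioi_of_hasDerivAt_of_nonneg' hderiv
    (fun x hx => mul_nonneg (Real.exp_pos _).le (le_of_lt hx)) hlim]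
  simp
  ring

/-- The Lévy continuity theorem in the form used here. -/
lemma tendsto_gaussianReal_of_tendsto_integral_exp {μ : ℕ → ProbabilityMeasure ℝ} {V : NNReal}
    (h : ∀ t : ℝ, t ≠ 0 → Tendsto (fun n => ∫ x, Complex.exp (t * x * Complex.I) ∂(μ n : Measure ℝ))
      atTop (𝓝 (Complex.exp (-((t ^ 2 * V / 2 : ℝ) : ℂ))))) :
    Tendsto μ atTop (𝓝 ⟨gaussianReal 0 V, inferInstance⟩) := by
  refine ProbabilityMeasure.tendsto_of_tendsto_charFun fun t => ?_
  rw [ProbabilityMeasure.coe_mk, charFun_gaussianReal]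
  rcases eq_or_ne t 0 with rfl | ht
  · simp
  · simp only [charFun_apply_real]
    convert h t ht using 3
    push_cast
    ring

/-- Almost sure weak convergence of conditional laws gives convergence in probability. -/
lemma tendsto_measure_notMem_of_ae_tendsto {Ω : Type*} [MeasurableSpace Ω] {P : Measure Ω}
    [IsProbabilityMeasure P] {κ : ℕ → Kernel Ω ℝ} [∀ n, IsMarkovKernel (κ n)]
    {G : ProbabilityMeasure ℝ}
    (h : ∀ᵐ ω ∂P, Tendsto (β := ProbabilityMeasure ℝ) (fun n => ⟨κ n ω, inferInstance⟩) atTop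
      (𝓝 G))
    {U : Set (ProbabilityMeasure ℝ)} (hU : U ∈ 𝓝 G) :
    Tendsto (fun n => P {ω | (⟨κ n ω, inferInstance⟩ : ProbabilityMeasure ℝ) ∉ U}) atTop (𝓝 0) := by
  -- The sets that the random laws leave with vanishing probability form a filter `F`. The claim is
  -- that `F` refines `𝓝 G`, which may be tested on integrals of bounded continuous functions;
  -- neither a metric nor measurability of `U` is needed.
  let F : Filter (ProbabilityMeasure ℝ) :=
    { sets := {U | Tendsto (fun n =>
        P {ω | (⟨κ n ω, inferInstance⟩ : ProbabilityMeasure ℝ) ∉ U}) atTop (𝓝 0)}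
      univ_sets := tendsto_const_nhds.congr fun n =>
        (measure_mono_null (t := ∅) (fun ω hω => (hω (Set.mem_univ _)).elim) measure_empty).symm
      sets_of_superset := fun {A B} hA hAB =>
        tendsto_of_tendsto_of_tendsto_of_le_of_le tendsto_const_nhds hA (fun _ => zero_le)
          fun n => measure_mono fun ω hω hω' => hω (hAB hω')
      inter_sets := fun {A B} hA hB => by
        have hadd := Tendsto.add hA hB
        rw [add_zero] at hadd
        refine tendsto_of_tendsto_of_tendsto_of_le_of_le tendsto_const_nhds hadd
          (fun _ => zero_le) fun n => ?_
        refine (measure_mono fun ω hω => ?_).trans (measure_union_le _ _)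
        by_contra hc
        simp only [Set.mem_union, Set.mem_ofPred_eq, not_or, not_not] at hc
        exact hω ⟨hc.1, hc.2⟩ }
  suffices hF : Tendsto id F (𝓝 G) from hF hU
  rw [ProbabilityMeasure.tendsto_iff_forall_integral_tendsto]
  intro f
  rw [Metric.tendsto_nhds]
  intro ε hε
  have hmeas : ∀ n, AEStronglyMeasurable (fun ω => ∫ x, f x ∂κ n ω) P := fun n =>
    (f.continuous.stronglyMeasurable.integral_kernel (κ := κ n)).aestronglyMeasurable
  have hm := tendstoInMeasure_of_tendsto_ae hmeas (g := fun _ => ∫ x, f x ∂(G : Measure ℝ)) (by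
    filter_upwards [h] with ω hω
    exact (ProbabilityMeasure.tendsto_iff_forall_integral_tendsto.1 hω) f)
  rw [tendstoInMeasure_iff_dist] at hm
  refine tendsto_of_tendsto_of_tendsto_of_le_of_le tendsto_const_nhds (hm ε hε)
    (fun _ => zero_le) fun n => measure_mono fun ω hω => ?_
  change ε ≤ _
  by_contra hc
  exact hω (not_le.1 hc)

end Weak

lemma sigma_sq {Ω : Type*} [MeasurableSpace Ω] (P : Measure Ω) (W : ℤ → Ω → ℝ) (n : ℕ) : sigma P W n ^ 2 = ∫ ω, S W n ω ^ 2 ∂P :=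
  Real.sq_sqrt (integral_nonneg fun _ => sq_nonneg _)

/-! ### Limit theorems under a general normalization `r n` -/

section Chain

variable {Ω : Type*} [MeasurableSpace Ω] {P : Measure Ω} [IsProbabilityMeasure P]
  {W : ℤ → Ω → ℝ}

lemma tendsto_freq_of_scale {r : ℕ → ℝ} {V : NNReal}
    (hr : Tendsto (fun n : ℕ => r n ^ 2 * (n * Real.log n)) atTop (𝓝 V)) (t : ℝ) :
    Tendsto (fun n : ℕ => (t * r n) ^ 2 * (n * Real.log n)) atTop (𝓝 (2 * (t ^ 2 * V / 2))) := by
  have := hr.const_mul (t ^ 2)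
  rw [show t ^ 2 * (V : ℝ) = 2 * (t ^ 2 * V / 2) by ring] at this
  refine this.congr fun n => ?_
  ring

lemma tendsto_integral_exp_scale {r : ℕ → ℝ} {V : NNReal} (hV : V ≠ 0)
    (hr : Tendsto (fun n : ℕ => r n ^ 2 * (n * Real.log n)) atTop (𝓝 V)) {w : ℝ} (hw : w ≠ 0)
    {t : ℝ} (ht : t ≠ 0) :
    Tendsto (fun n => ∫ y, Complex.exp ((t * r n : ℝ) * y.1 * Complex.I) ∂sumState n w) atTop
      (𝓝 (Complex.exp (-((t ^ 2 * V / 2 : ℝ) : ℂ)))) :=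
  tendsto_integral_exp_sumState (by positivity) (tendsto_freq_of_scale hr t) hw

/-- Quenched central limit theorem: every nonzero starting point. -/
lemma tendsto_map_sumState {r : ℕ → ℝ} {V : NNReal} (hV : V ≠ 0)
    (hr : Tendsto (fun n : ℕ => r n ^ 2 * (n * Real.log n)) atTop (𝓝 V)) {w : ℝ} (hw : w ≠ 0) :
    Tendsto (β := ProbabilityMeasure ℝ) (fun n => ⟨(sumState n w).map fun y => r n * y.1,
      Measure.isProbabilityMeasure_map (by fun_prop)⟩) atTop
      (𝓝 ⟨gaussianReal 0 V, inferInstance⟩) := by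
  refine tendsto_gaussianReal_of_tendsto_integral_exp fun t ht => ?_
  refine (tendsto_integral_exp_scale hV hr hw ht).congr fun n => ?_
  rw [ProbabilityMeasure.coe_mk, integral_map (by fun_prop) (by fun_prop)]
  refine integral_congr_ae (ae_of_all _ fun y => ?_)
  simp only
  congr 1
  push_cast
  ring

/-- Unconditional central limit theorem. -/
lemma IsStationaryMarkovChain.tendstoInDistribution (hW : IsStationaryMarkovChain P Q pi W)
    {r : ℕ → ℝ} {V : NNReal} (hV : V ≠ 0)
    (hr : Tendsto (fun n : ℕ => r n ^ 2 * (n * Real.log n)) atTop (𝓝 V)) :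
    TendstoInDistribution (fun (n : ℕ) ω => r n * S W n ω) atTop (id : ℝ → ℝ) (fun _ => P)
      (gaussianReal 0 V) := by
  have hm : ∀ n, Measurable fun ω => r n * S W n ω := fun n => (hW.measurable_sum n).const_mul _
  refine ⟨fun n => (hm n).aemeasurable, aemeasurable_id, ?_⟩
  simp only [Measure.map_id]
  refine tendsto_gaussianReal_of_tendsto_integral_exp fun t ht => ?_
  have hlim : Tendsto (fun n => ∫ w, ∫ y, Complex.exp ((t * r n : ℝ) * y.1 * Complex.I)
      ∂sumState n w ∂pi) atTop (𝓝 (∫ _w, Complex.exp (-((t ^ 2 * V / 2 : ℝ) : ℂ)) ∂pi)) := by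
    refine tendsto_integral_of_dominated_convergence (fun _ => 1) (fun n => ?_)
      (integrable_const _) (fun n => ae_of_all _ fun w => ?_) ?_
    · have : StronglyMeasurable fun y : ℝ × ℝ => Complex.exp ((t * r n : ℝ) * y.1 * Complex.I) :=
        (by fun_prop : Measurable fun y : ℝ × ℝ =>
          Complex.exp ((t * r n : ℝ) * y.1 * Complex.I)).stronglyMeasurable
      exact (this.integral_kernel (κ := sumState n)).aestronglyMeasurable
    · refine (norm_integral_le_of_norm_le_const (C := 1)
        (ae_of_all _ fun y => (norm_exp_mul_I _ _).le)).trans ?_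
      simp
    · filter_upwards [ae_ne_zero_pi] with w hw using tendsto_integral_exp_scale hV hr hw ht
  rw [integral_const, probReal_univ, one_smul] at hlim
  refine hlim.congr fun n => ?_
  have hjoint : Measurable fun ω => (W 0 ω, (S W n ω, W n ω)) :=
    (hW.measurable 0).prodMk ((hW.measurable_sum n).prodMk (hW.measurable n))
  have hf : Measurable fun q : ℝ × ℝ × ℝ => Complex.exp ((t * r n : ℝ) * q.2.1 * Complex.I) := by
    fun_prop
  have e : ∫ q, Complex.exp ((t * r n : ℝ) * q.2.1 * Complex.I) ∂(pi ⊗ₘ sumState n) =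
      ∫ w, ∫ y, Complex.exp ((t * r n : ℝ) * y.1 * Complex.I) ∂sumState n w ∂pi :=
    Measure.integral_compProd (integrable_of_norm_le hf.aestronglyMeasurable fun q =>
      (norm_exp_mul_I _ _).le)
  rw [← e, ← hW.map_sumState n, integral_map hjoint.aemeasurable hf.aestronglyMeasurable]
  rw [ProbabilityMeasure.coe_mk, integral_map (hm n).aemeasurable
    (by fun_prop : Measurable fun x : ℝ => Complex.exp (t * x * Complex.I)).aestronglyMeasurable]
  refine integral_congr_ae (ae_of_all _ fun y => ?_)
  simp only
  congr 1
  push_cast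
  ring

lemma IsStationaryMarkovChain.condDistrib_ae_eq (hW : IsStationaryMarkovChain P Q pi W)
    (r : ℝ) (n : ℕ) :
    condDistrib (fun ω => r * S W n ω) (W 0) P =ᵐ[pi]
      (sumState n).map (fun y : ℝ × ℝ => r * y.1) := by
  have hm : Measurable fun ω => r * S W n ω := (hW.measurable_sum n).const_mul _
  have hf : Measurable fun y : ℝ × ℝ => r * y.1 := by fun_prop
  have : IsMarkovKernel ((sumState n).map fun y : ℝ × ℝ => r * y.1) :=
    Kernel.IsMarkovKernel.map _ hf
  have h := condDistrib_ae_eq_of_measure_eq_compProd (μ := P) (W 0) hm.aemeasurable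
    (κ := (sumState n).map fun y : ℝ × ℝ => r * y.1) ?_
  · rwa [hW.marginal 0] at h
  · have hφ : Measurable fun q : ℝ × ℝ × ℝ => (q.1, r * q.2.1) := by fun_prop
    have e : (fun ω => (W 0 ω, r * S W n ω)) =
        (fun q : ℝ × ℝ × ℝ => (q.1, r * q.2.1)) ∘ fun ω => (W 0 ω, (S W n ω, W n ω)) := rfl
    rw [e, ← Measure.map_map hφ ((hW.measurable 0).prodMk
      ((hW.measurable_sum n).prodMk (hW.measurable n))), hW.map_sumState n, hW.marginal 0]
    refine Measure.ext_of_lintegral _ fun f hfm => ?_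
    rw [lintegral_map hfm hφ,
      Measure.lintegral_compProd (f := fun q : ℝ × ℝ × ℝ => f (q.1, r * q.2.1)) (hfm.comp hφ), Measure.lintegral_compProd hfm]
    refine lintegral_congr fun w => ?_
    rw [Kernel.lintegral_map _ hf w (g' := fun z => f (w, z)) (hfm.comp measurable_prodMk_left)]

/-- Conditional central limit theorem. -/
lemma IsStationaryMarkovChain.tendstoInCondDistribution (hW : IsStationaryMarkovChain P Q pi W)
    {r : ℕ → ℝ} {V : NNReal} (hV : V ≠ 0)
    (hr : Tendsto (fun n : ℕ => r n ^ 2 * (n * Real.log n)) atTop (𝓝 V)) :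
    TendstoInCondDistribution P (fun n ω => r n * S W n ω) (W 0)
      ⟨gaussianReal 0 V, inferInstance⟩ := by
  intro U hU
  have hae : ∀ᵐ w ∂pi, Tendsto (β := ProbabilityMeasure ℝ)
      (fun n => ⟨condDistrib (fun ω => r n * S W n ω) (W 0) P w, inferInstance⟩) atTop (𝓝 ⟨gaussianReal 0 V, inferInstance⟩) := by
    filter_upwards [ae_ne_zero_pi, ae_all_iff.2 fun n => hW.condDistrib_ae_eq (r n) n]
      with w hw hall
    refine (tendsto_map_sumState hV hr hw).congr fun n => Subtype.ext ?_
    have hf : Measurable fun y : ℝ × ℝ => r n * y.1 := by fun_prop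
    have := hall n
    rw [Kernel.map_apply _ hf] at this
    exact this.symm
  rw [← hW.marginal 0] at hae
  have hae' := ae_of_ae_map (hW.measurable 0).aemeasurable hae
  exact tendsto_measure_notMem_of_ae_tendsto
    (κ := fun n => (condDistrib (fun ω => r n * S W n ω) (W 0) P).comap (W 0) (hW.measurable 0))
    hae' hU

/-! ### Variance normalization, slow variation and the first absolute moment -/

lemma IsStationaryMarkovChain.tendsto_sigma_sq_div (hW : IsStationaryMarkovChain P Q pi W) :
    Tendsto (fun n : ℕ => sigma P W n ^ 2 / (n * Real.log n)) atTop (𝓝 2) := by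
  rw [tendsto_iff_norm_sub_tendsto_zero]
  have hb : Tendsto (fun n : ℕ => 3 / Real.log n) atTop (𝓝 0) :=
    tendsto_const_nhds.div_atTop tendsto_log_nat_atTop
  refine squeeze_zero' (Eventually.of_forall fun _ => norm_nonneg _) ?_ hb
  filter_upwards [eventually_log_pos, eventually_gt_atTop 0] with n hn hn0
  have hn1 : (0 : ℝ) < n := by exact_mod_cast hn0
  have h := hW.abs_integral_S_sq_sub_le hn0
  rw [sigma_sq]
  have e : (∫ ω, S W n ω ^ 2 ∂P) / (n * Real.log n) - 2 =
      (∫ ω, S W n ω ^ 2 ∂P - 2 * (n * Real.log n)) / (n * Real.log n) := by field_simp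
  rw [e, norm_div, Real.norm_eq_abs, Real.norm_of_nonneg (by positivity : 0 ≤ n * Real.log n),
    div_le_div_iff₀ (by positivity) hn]
  nlinarith

lemma IsStationaryMarkovChain.sigma_sq_isEquivalent (hW : IsStationaryMarkovChain P Q pi W) :
    Asymptotics.IsEquivalent atTop (fun n : ℕ => sigma P W n ^ 2)
      (fun n : ℕ => 2 * (n : ℝ) * Real.log n) := by
  refine Asymptotics.isEquivalent_of_tendsto_one ?_
  have := hW.tendsto_sigma_sq_div.div_const 2
  rw [div_self two_ne_zero] at this
  refine this.congr fun n => ?_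
  rw [Pi.div_apply, div_div]
  congr 1
  ring

lemma IsStationaryMarkovChain.tendsto_ell_div_log (hW : IsStationaryMarkovChain P Q pi W) :
    Tendsto (fun n : ℕ => ell P W n / Real.log n) atTop (𝓝 2) :=
  hW.tendsto_sigma_sq_div.congr fun n => by rw [ell, div_div]

lemma IsStationaryMarkovChain.ell_isEquivalent (hW : IsStationaryMarkovChain P Q pi W) :
    Asymptotics.IsEquivalent atTop (ell P W) (fun n : ℕ => 2 * Real.log n) := by
  refine Asymptotics.isEquivalent_of_tendsto_one ?_
  have := hW.tendsto_ell_div_log.div_const 2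
  rw [div_self two_ne_zero] at this
  refine this.congr fun n => ?_
  rw [Pi.div_apply, div_div, mul_comm]

/-- The difference of the two logarithms tends to `log c`, which `log n` swamps. -/
lemma tendsto_log_floor_div_log {c : ℝ} (hc : 0 < c) :
    Tendsto (fun n : ℕ => Real.log (⌊c * n⌋₊ : ℝ) / Real.log n) atTop (𝓝 1) := by
  have h1 : Tendsto (fun n : ℕ => (⌊c * n⌋₊ : ℝ) / n) atTop (𝓝 c) :=
    (tendsto_nat_floor_mul_div_atTop hc.le).comp tendsto_natCast_atTop_atTop
  have h2 := ((h1.log hc.ne').div_atTop tendsto_log_nat_atTop).add_const 1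
  rw [zero_add] at h2
  refine h2.congr' ?_
  filter_upwards [eventually_log_pos, eventually_gt_atTop 0, h1.eventually_ne hc.ne']
    with n hn hn0 hne
  have hn1 : (n : ℝ) ≠ 0 := by exact_mod_cast hn0.ne'
  rw [Real.log_div (fun h0 => hne (by rw [h0, zero_div])) hn1]
  field_simp
  ring

lemma tendsto_floor_mul_atTop {c : ℝ} (hc : 0 < c) :
    Tendsto (fun n : ℕ => ⌊c * n⌋₊) atTop atTop :=
  tendsto_nat_floor_atTop.comp (tendsto_natCast_atTop_atTop.const_mul_atTop hc)

lemma IsStationaryMarkovChain.ell_isSlowlyVarying (hW : IsStationaryMarkovChain P Q pi W) :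
    IsSlowlyVarying (ell P W) := by
  have h := hW.tendsto_ell_div_log
  refine ⟨?_, fun c hc => ?_⟩
  · filter_upwards [eventually_log_pos, h.eventually_const_lt two_pos] with n hn hn'
    exact (div_pos_iff_of_pos_right hn).1 hn'
  · have hfl := tendsto_floor_mul_atTop hc
    have h1 := ((h.comp hfl).mul (tendsto_log_floor_div_log hc)).div h two_ne_zero
    rw [mul_one, div_self two_ne_zero] at h1
    refine h1.congr' ?_
    filter_upwards [eventually_log_pos, hfl.eventually eventually_log_pos] with n hn hn'
    simp only [Pi.div_apply, Function.comp]
    field_simp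

/-- The limit is the variance parameter of the general limit theorems, so normalizing by `σ_n` gives
variance 1/2. -/
lemma IsStationaryMarkovChain.tendsto_sigma_scale (hW : IsStationaryMarkovChain P Q pi W) :
    Tendsto (fun n : ℕ => (sigma P W n)⁻¹ ^ 2 * (n * Real.log n)) atTop
      (𝓝 ((1 / 2 : NNReal) : ℝ)) := by
  have h := hW.tendsto_sigma_sq_div.inv₀ two_ne_zero
  have e : ((1 / 2 : NNReal) : ℝ) = 2⁻¹ := by push_cast; norm_num
  rw [e]
  refine h.congr fun n => ?_
  rw [inv_div, div_eq_mul_inv, inv_pow, mul_comm]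

lemma IsStationaryMarkovChain.eventually_sigma_pos (hW : IsStationaryMarkovChain P Q pi W) :
    ∀ᶠ n : ℕ in atTop, 0 < sigma P W n := by
  filter_upwards [hW.tendsto_sigma_sq_div.eventually_ne two_ne_zero] with n hn
  refine lt_of_le_of_ne (Real.sqrt_nonneg _) fun h0 => hn ?_
  rw [← h0]
  simp

lemma half_ne_zero_nnreal : (1 / 2 : NNReal) ≠ 0 := by norm_num

/-- The normalized sums have second moment 1 once `σ_n > 0`, so weak convergence carries first
absolute moments to that of the Gaussian limit. -/
lemma IsStationaryMarkovChain.tendsto_integral_abs_div_sigma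
    (hW : IsStationaryMarkovChain P Q pi W) :
    Tendsto (fun n : ℕ => (∫ ω, |S W n ω| ∂P) / sigma P W n) atTop (𝓝 (√Real.pi)⁻¹) := by
  have hlaw := (hW.tendstoInDistribution half_ne_zero_nnreal hW.tendsto_sigma_scale).tendsto
  simp only [Measure.map_id] at hlaw
  have hm : ∀ n, Measurable fun ω => (sigma P W n)⁻¹ * S W n ω :=
    fun n => (hW.measurable_sum n).const_mul _
  have hG : Integrable (fun x : ℝ => x ^ 2) (gaussianReal 0 (1 / 2)) :=
    (memLp_id_gaussianReal 2).integrable_sq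
  have h := tendsto_integral_abs_of_tendsto hlaw
    (C := max 1 (∫ x, x ^ 2 ∂gaussianReal 0 (1 / 2))) ?_ hG (le_max_right _ _)
  · rw [ProbabilityMeasure.coe_mk, integral_abs_gaussianReal] at h
    refine h.congr' ?_
    filter_upwards [hW.eventually_sigma_pos] with n hn
    rw [ProbabilityMeasure.coe_mk, integral_map (hm n).aemeasurable (by fun_prop)]
    simp only [abs_mul, abs_of_pos (inv_pos.2 hn)]
    rw [integral_const_mul, div_eq_inv_mul]
  · filter_upwards [hW.eventually_sigma_pos] with n hn
    rw [ProbabilityMeasure.coe_mk]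
    have hsq : Measurable fun x : ℝ => x ^ 2 := by fun_prop
    constructor
    · rw [integrable_map_measure hsq.aestronglyMeasurable (hm n).aemeasurable]
      refine integrable_of_norm_le (hsq.comp (hm n)).aestronglyMeasurable
        (C := ((sigma P W n)⁻¹ * n) ^ 2) fun ω => ?_
      rw [Function.comp, norm_pow, norm_mul, Real.norm_of_nonneg (inv_pos.2 hn).le]
      exact pow_le_pow_left₀ (by positivity) (mul_le_mul_of_nonneg_left (abs_S_le W n ω)
        (inv_pos.2 hn).le) 2
    · rw [integral_map (hm n).aemeasurable hsq.aestronglyMeasurable]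
      simp only [mul_pow]
      rw [integral_const_mul, ← sigma_sq, ← mul_pow, inv_mul_cancel₀ hn.ne', one_pow]
      exact le_max_left _ _

lemma pi_rpow_neg_half : Real.pi ^ (-(1 / 2) : ℝ) = (√Real.pi)⁻¹ := by
  rw [Real.rpow_neg Real.pi_pos.le, ← Real.sqrt_eq_rpow]

lemma IsStationaryMarkovChain.integral_abs_isEquivalent
    (hW : IsStationaryMarkovChain P Q pi W) :
    Asymptotics.IsEquivalent atTop (fun n : ℕ => ∫ ω, |S W n ω| ∂P)
      (fun n : ℕ => Real.pi ^ (-(1 / 2) : ℝ) * sigma P W n) := by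
  have hpi : √Real.pi ≠ 0 := (Real.sqrt_pos.2 Real.pi_pos).ne'
  refine Asymptotics.isEquivalent_of_tendsto_one ?_
  have := hW.tendsto_integral_abs_div_sigma.const_mul √Real.pi
  rw [mul_inv_cancel₀ hpi] at this
  refine this.congr fun n => ?_
  rw [Pi.div_apply, pi_rpow_neg_half, div_mul_eq_div_div, div_inv_eq_mul]
  ring

lemma IsStationaryMarkovChain.tendsto_abs_scale (hW : IsStationaryMarkovChain P Q pi W) :
    Tendsto (fun n : ℕ => (∫ ω, |S W n ω| ∂P)⁻¹ ^ 2 * (n * Real.log n)) atTop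
      (𝓝 (Real.toNNReal (Real.pi / 2) : ℝ)) := by
  have hpi : (√Real.pi)⁻¹ ≠ 0 := inv_ne_zero (Real.sqrt_pos.2 Real.pi_pos).ne'
  have h := ((hW.tendsto_integral_abs_div_sigma.inv₀ hpi).pow 2).mul hW.tendsto_sigma_scale
  have e : (√Real.pi)⁻¹⁻¹ ^ 2 * ((1 / 2 : NNReal) : ℝ) = (Real.toNNReal (Real.pi / 2) : ℝ) := by
    rw [Real.coe_toNNReal _ (by positivity), inv_inv, Real.sq_sqrt Real.pi_pos.le]
    push_cast
    ring
  rw [e] at h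
  refine h.congr' ?_
  filter_upwards [hW.eventually_sigma_pos] with n hn
  rw [inv_div, div_eq_mul_inv, mul_pow, inv_pow (sigma P W n)]
  field_simp

end Chain


/-! ### Splitting off the first coordinate of an i.i.d. sequence -/

section SplitProduct

variable {E : Type*} [MeasurableSpace E] (lam : Measure E) [IsProbabilityMeasure lam]

/-- Prepend a term to a sequence. -/
def consSeq (q : E × (ℕ → E)) : ℕ → E
  | 0 => q.1
  | n + 1 => q.2 n

lemma measurable_consSeq : Measurable (consSeq : E × (ℕ → E) → ℕ → E) := by
  refine measurable_pi_lambda _ fun n => ?_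
  cases n with
  | zero => exact measurable_fst
  | succ n => exact (measurable_pi_apply n).comp measurable_snd

/-- The infinite product of a law is invariant under prepending an independent term. -/
lemma map_consSeq :
    (lam.prod (Measure.infinitePi fun _ : ℕ => lam)).map consSeq =
      Measure.infinitePi fun _ : ℕ => lam := by
  refine Measure.eq_infinitePi _ fun s t ht => ?_
  classical
  -- Padding with `univ` up to an initial segment makes the cylinder a product of its coordinate 0
  -- and a shifted cylinder.
  set t' : ℕ → Set E := fun i => if i ∈ s then t i else Set.univ with ht'
  have hmt' : ∀ i, MeasurableSet (t' i) := fun i => by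
    simp only [ht']
    split_ifs
    exacts [ht i, MeasurableSet.univ]
  obtain ⟨N, hN⟩ : ∃ N, s ⊆ Finset.range (N + 1) := by
    obtain ⟨N, hN⟩ := s.exists_nat_subset_range
    exact ⟨N, hN.trans (Finset.range_mono (Nat.le_succ N))⟩
  have hprod : ∏ i ∈ s, lam (t i) = ∏ i ∈ Finset.range (N + 1), lam (t' i) := by
    rw [← Finset.prod_subset hN fun i _ hi => by simp [ht', hi]]
    exact Finset.prod_congr rfl fun i hi => by simp [ht', hi]
  have hpre : consSeq ⁻¹' (Set.pi s t) =
      t' 0 ×ˢ Set.pi (Finset.range N) (fun i => t' (i + 1)) := by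
    ext ⟨e, ξ⟩
    simp only [Set.mem_preimage, Set.mem_pi, Finset.mem_coe, Set.mem_prod, ht']
    constructor
    · intro h
      refine ⟨?_, fun i _ => ?_⟩
      · split_ifs with h0
        exacts [h 0 h0, Set.mem_univ _]
      · split_ifs with hi
        exacts [h (i + 1) hi, Set.mem_univ _]
    · rintro ⟨h0, h1⟩ i hi
      cases i with
      | zero =>
        rw [if_pos hi] at h0
        exact h0
      | succ i =>
        have := h1 i (Finset.mem_range.2 (by have := Finset.mem_range.1 (hN hi); omega))
        rw [if_pos hi] at this
        exact this
  have hms : MeasurableSet (Set.pi (s : Set ℕ) t) :=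
    MeasurableSet.pi s.countable_toSet fun i _ => ht i
  rw [Measure.map_apply measurable_consSeq hms, hpre, Measure.prod_prod,
    Measure.infinitePi_pi _ fun i _ => hmt' (i + 1), hprod, Finset.prod_range_succ', mul_comm]

lemma lintegral_infinitePi_cons {f : (ℕ → E) → ENNReal} (hf : Measurable f) :
    ∫⁻ ξ, f ξ ∂(Measure.infinitePi fun _ : ℕ => lam) =
      ∫⁻ e, ∫⁻ ξ, f (consSeq (e, ξ)) ∂(Measure.infinitePi fun _ : ℕ => lam) ∂lam := by
  have hm : Measurable fun q : E × (ℕ → E) => f (consSeq q) := hf.comp measurable_consSeq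
  conv_lhs => rw [← map_consSeq lam]
  rw [lintegral_map hf measurable_consSeq, lintegral_prod _ hm.aemeasurable]

end SplitProduct

/-! ### Construction of the two-sided stationary chain -/

section Path

variable {E : Type*} [MeasurableSpace E] {lam : Measure E} [IsProbabilityMeasure lam]
  {F : ℝ → E → ℝ}

/-- The path started at `x` and driven by the noise `ξ` through the recursion `F`. -/
def drivenPath {E : Type*} (F : ℝ → E → ℝ) (x : ℝ) (ξ : ℕ → E) : ℕ → ℝ
  | 0 => x
  | n + 1 => F (drivenPath F x ξ n) (ξ n)

lemma drivenPath_cons {E : Type*} (F : ℝ → E → ℝ) (x : ℝ) (e : E) (ξ : ℕ → E) (n : ℕ) :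
    drivenPath F x (consSeq (e, ξ)) (n + 1) = drivenPath F (F x e) ξ n := by
  induction n with
  | zero => rfl
  | succ n ih => rw [drivenPath, ih]; rfl

lemma measurable_drivenPath (hF : Measurable (Function.uncurry F)) :
    Measurable fun q : ℝ × (ℕ → E) => drivenPath F q.1 q.2 := by
  refine measurable_pi_lambda _ fun n => ?_
  induction n with
  | zero => exact measurable_fst
  | succ n ih =>
    exact hF.comp (ih.prodMk ((measurable_pi_apply n).comp measurable_snd))

/-- A two-sided sequence from its values at nonnegative and at negative times. -/
def glue (q : (ℕ → ℝ) × (ℕ → ℝ)) (k : ℤ) : ℝ :=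
  -- Time `-1` is index 0 of the second sequence; time 0 belongs to the first.
  if 0 ≤ k then q.1 k.toNat else q.2 ((-k).toNat - 1)

lemma measurable_glue : Measurable glue := by
  refine measurable_pi_lambda _ fun k => ?_
  unfold glue
  split_ifs
  exacts [(measurable_pi_apply _).comp measurable_fst, (measurable_pi_apply _).comp measurable_snd]

/-- The two-sided path through `x` at time `0`, driven by independent noises in both directions. -/
def twoSided {E : Type*} (F : ℝ → E → ℝ) (q : ℝ × (ℕ → E) × (ℕ → E)) : ℤ → ℝ :=
  glue (drivenPath F q.1 q.2.1, fun k => drivenPath F q.1 q.2.2 (k + 1))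

lemma measurable_twoSided (hF : Measurable (Function.uncurry F)) :
    Measurable (twoSided F) := by
  have hp := measurable_drivenPath hF
  refine measurable_glue.comp (Measurable.prodMk ?_ ?_)
  · exact hp.comp (measurable_fst.prodMk measurable_snd.fst)
  · refine measurable_pi_lambda _ fun k => ?_
    exact (measurable_pi_apply (k + 1)).comp (hp.comp (measurable_fst.prodMk measurable_snd.snd))

/-- Exposing the first backward noise writes the path as forward and backward branches issuing from
the adjacent states `x` and `F x e`. -/
lemma twoSided_cons_right {E : Type*} (F : ℝ → E → ℝ) (x : ℝ) (ξ η : ℕ → E) (e : E) :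
    twoSided F (x, ξ, consSeq (e, η)) = glue (drivenPath F x ξ, drivenPath F (F x e) η) := by
  unfold twoSided
  congr 2
  ext k
  exact drivenPath_cons F x e η k

/-- Exposing the first forward noise and shifting gives the same picture with the two adjacent
states exchanged. -/
lemma twoSided_cons_left_shift {E : Type*} (F : ℝ → E → ℝ) (x : ℝ) (ξ η : ℕ → E) (e : E) :
    (fun k => twoSided F (x, consSeq (e, ξ), η) (k + 1)) =
      glue (drivenPath F (F x e) ξ, drivenPath F x η) := by
  ext k
  simp only [twoSided, glue]
  by_cases hk : 0 ≤ k
  · rw [if_pos (by omega), if_pos hk, show (k + 1).toNat = k.toNat + 1 by omega, drivenPath_cons]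
  · rw [if_neg hk]
    by_cases hk1 : k = -1
    · subst hk1
      simp [drivenPath]
    · rw [if_neg (by omega)]
      congr 1
      omega

/-- The law of the two-sided path with marginal `μ`. -/
noncomputable def twoSidedLaw (lam : Measure E) (F : ℝ → E → ℝ) (μ : Measure ℝ) :
    Measure (ℤ → ℝ) :=
  (μ.prod ((Measure.infinitePi fun _ : ℕ => lam).prod
    (Measure.infinitePi fun _ : ℕ => lam))).map (twoSided F)

lemma measurable_shift (n : ℤ) : Measurable fun (ω : ℤ → ℝ) (k : ℤ) => ω (k + n) :=
  measurable_pi_lambda _ fun k => measurable_pi_apply (k + n)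

variable {κ : Kernel ℝ ℝ} [IsMarkovKernel κ] {μ : Measure ℝ} [IsProbabilityMeasure μ]

lemma isProbabilityMeasure_twoSidedLaw (hF : Measurable (Function.uncurry F)) :
    IsProbabilityMeasure (twoSidedLaw lam F μ) :=
  Measure.isProbabilityMeasure_map (measurable_twoSided hF).aemeasurable

lemma lintegral_swap_of_isReversible (hrev : Kernel.IsReversible κ μ) {f : ℝ × ℝ → ENNReal}
    (hf : Measurable f) : ∫⁻ x, ∫⁻ y, f (y, x) ∂κ x ∂μ = ∫⁻ x, ∫⁻ y, f (x, y) ∂κ x ∂μ := by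
  have hsymm : (μ ⊗ₘ κ).map Prod.swap = μ ⊗ₘ κ := by
    have := Measure.isProbabilityMeasure_map (μ := μ ⊗ₘ κ) measurable_swap.aemeasurable
    refine Measure.ext_prod fun {A B} hA hB => ?_
    rw [Measure.map_apply measurable_swap (hA.prod hB), Set.preimage_swap_prod,
      Measure.compProd_apply_prod hB hA, Measure.compProd_apply_prod hA hB]
    exact hrev hB hA
  rw [← Measure.lintegral_compProd hf, ← Measure.lintegral_compProd (f := fun q => f (q.2, q.1))
    (hf.comp measurable_swap), ← hsymm, lintegral_map hf measurable_swap, hsymm]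
  rfl

lemma lintegral_kernel_eq {lam : Measure E} {κ : Kernel ℝ ℝ} (hF : Measurable (Function.uncurry F))
    (hκ : ∀ x, lam.map (F x) = κ x) (x : ℝ) {f : ℝ → ENNReal} (hf : Measurable f) :
    ∫⁻ e, f (F x e) ∂lam = ∫⁻ y, f y ∂κ x := by
  rw [← hκ x, lintegral_map hf hF.of_uncurry_left]

/-- Shifted and unshifted paths are the same function of two adjacent states and independent noises,
with the states in opposite order. Reversibility says exactly that this pair is exchangeable. -/
lemma twoSidedLaw_map_shift_one (hF : Measurable (Function.uncurry F))
    (hκ : ∀ x, lam.map (F x) = κ x) (hrev : Kernel.IsReversible κ μ) :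
    (twoSidedLaw lam F μ).map (fun ω k => ω (k + 1)) = twoSidedLaw lam F μ := by
  have hT := measurable_twoSided hF
  have hp := measurable_drivenPath hF
  set prodLaw := Measure.infinitePi fun _ : ℕ => lam
  refine Measure.ext_of_lintegral _ fun f hf => ?_
  have hsT : Measurable fun q => f (fun k => twoSided F q (k + 1)) :=
    hf.comp ((measurable_shift 1).comp hT)
  have hfT : Measurable fun q => f (twoSided F q) := hf.comp hT
  set G : ((ℝ × ℝ) × ((ℕ → E) × (ℕ → E))) → ENNReal := fun q =>
    f (glue (drivenPath F q.1.1 q.2.1, drivenPath F q.1.2 q.2.2)) with hG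
  have hGm : Measurable G := hf.comp (measurable_glue.comp
    ((hp.comp (measurable_fst.fst.prodMk measurable_snd.fst)).prodMk
      (hp.comp (measurable_fst.snd.prodMk measurable_snd.snd))))
  set H : ℝ × ℝ → ENNReal := fun r => ∫⁻ ξ, ∫⁻ η, G (r, ξ, η) ∂prodLaw ∂prodLaw with hH
  have hHm : Measurable H := by
    have h1 : Measurable fun r : (ℝ × ℝ) × (ℕ → E) => ∫⁻ η, G (r.1, r.2, η) ∂prodLaw :=
      Measurable.lintegral_prod_right' (f := fun z : ((ℝ × ℝ) × (ℕ → E)) × (ℕ → E) =>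
        G (z.1.1, z.1.2, z.2))
        (hGm.comp (measurable_fst.fst.prodMk (measurable_fst.snd.prodMk measurable_snd)))
    exact Measurable.lintegral_prod_right' h1
  have hfs : Measurable fun ω : ℤ → ℝ => f (fun k => ω (k + 1)) := hf.comp (measurable_shift 1)
  rw [lintegral_map hf (measurable_shift 1), twoSidedLaw, lintegral_map hfs hT, lintegral_map hf hT,
    lintegral_prod _ hsT.aemeasurable, lintegral_prod _ hfT.aemeasurable]
  have hleft : ∀ x, ∫⁻ q, f (fun k => twoSided F (x, q) (k + 1)) ∂(prodLaw.prod prodLaw) =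
      ∫⁻ y, H (y, x) ∂κ x := fun x => by
    have hm : Measurable fun q : (ℕ → E) × (ℕ → E) => f (fun k => twoSided F (x, q) (k + 1)) :=
      hsT.comp measurable_prodMk_left
    rw [lintegral_prod _ hm.aemeasurable,
      lintegral_infinitePi_cons lam hm.lintegral_prod_right']
    simp only [twoSided_cons_left_shift]
    exact lintegral_kernel_eq hF hκ x (f := fun y => H (y, x))
      (hHm.comp measurable_prodMk_right)
  have hright : ∀ x, ∫⁻ q, f (twoSided F (x, q)) ∂(prodLaw.prod prodLaw) = ∫⁻ y, H (x, y) ∂κ x := fun x => by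
    have hm : Measurable fun q : (ℕ → E) × (ℕ → E) => f (twoSided F (x, q)) :=
      hfT.comp measurable_prodMk_left
    rw [lintegral_prod _ hm.aemeasurable]
    have hsplit : ∀ ξ : ℕ → E, ∫⁻ η, f (twoSided F (x, ξ, η)) ∂prodLaw =
        ∫⁻ e, ∫⁻ η, G ((x, F x e), ξ, η) ∂prodLaw ∂lam := fun ξ => by
      have hmξ : Measurable fun η => f (twoSided F (x, ξ, η)) := hm.comp measurable_prodMk_left
      rw [lintegral_infinitePi_cons lam hmξ]
      simp only [twoSided_cons_right, hG]
      rfl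
    simp only [hsplit]
    have hFx : Measurable (F x) := hF.of_uncurry_left
    have hm2 : Measurable fun q : (ℕ → E) × E => ∫⁻ η, G ((x, F x q.2), q.1, η) ∂prodLaw :=
      Measurable.lintegral_prod_right' (f := fun z : ((ℕ → E) × E) × (ℕ → E) =>
        G ((x, F x z.1.2), z.1.1, z.2)) (hGm.comp
          ((measurable_const.prodMk (hFx.comp measurable_fst.snd)).prodMk
            (measurable_fst.fst.prodMk measurable_snd)))
    rw [lintegral_lintegral_swap hm2.aemeasurable]
    exact lintegral_kernel_eq hF hκ x (f := fun y => H (x, y)) (hHm.comp measurable_prodMk_left)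
  exact (lintegral_congr hleft).trans
    ((lintegral_swap_of_isReversible hrev hHm).trans (lintegral_congr hright).symm)

lemma twoSidedLaw_map_shift (hF : Measurable (Function.uncurry F))
    (hκ : ∀ x, lam.map (F x) = κ x) (hrev : Kernel.IsReversible κ μ) (n : ℤ) :
    (twoSidedLaw lam F μ).map (fun ω k => ω (k + n)) = twoSidedLaw lam F μ := by
  have h1 := twoSidedLaw_map_shift_one hF hκ hrev
  have hadd : ∀ m n : ℤ, ((twoSidedLaw lam F μ).map fun ω k => ω (k + m)).map
      (fun ω k => ω (k + n)) = (twoSidedLaw lam F μ).map fun ω k => ω (k + (n + m)) := fun m n => by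
    rw [Measure.map_map (measurable_shift n) (measurable_shift m)]
    congr 1
    ext ω k
    simp [add_assoc]
  have h0 : (twoSidedLaw lam F μ).map (fun ω k => ω (k + 0)) = twoSidedLaw lam F μ := by
    simp only [add_zero]
    exact Measure.map_id
  induction n using Int.induction_on with
  | zero => exact h0
  | succ n ih => rw [← hadd 1 n, h1, ih]
  | pred n ih =>
    -- Invariance under the inverse shift follows by applying that shift to the already invariant
    -- law.
    have h2 : (twoSidedLaw lam F μ).map (fun ω k => ω (k + (-1))) = twoSidedLaw lam F μ := by
      conv_lhs => rw [← h1]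
      rw [hadd 1 (-1)]
      exact h0
    rw [sub_eq_add_neg, ← hadd (-1) (-n), h2, ih]

lemma twoSidedLaw_map_zero {μ : Measure ℝ} (hF : Measurable (Function.uncurry F)) :
    (twoSidedLaw lam F μ).map (fun ω => ω 0) = μ := by
  rw [twoSidedLaw, Measure.map_map (measurable_pi_apply 0) (measurable_twoSided hF)]
  have : ((fun ω : ℤ → ℝ => ω 0) ∘ twoSided F) = Prod.fst := by
    ext q
    simp [twoSided, glue, drivenPath]
  rw [this]
  exact Measure.fst_prod

lemma twoSided_nonpos {E : Type*} (F : ℝ → E → ℝ) (x : ℝ) (ξ η : ℕ → E) (k : ℕ) :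
    twoSided F (x, ξ, η) (0 - (k : ℤ)) = drivenPath F x η k := by
  cases k with
  | zero => simp [twoSided, glue, drivenPath]
  | succ k =>
    simp only [twoSided, glue]
    rw [if_neg (by push_cast; omega)]
    congr 1

lemma measurable_pastSeq (n : ℤ) : Measurable fun (ω : ℤ → ℝ) (k : ℕ) => ω (n - k) :=
  measurable_pi_lambda _ fun _ => measurable_pi_apply _

/-- Stationarity reduces to `n = 0`. There the past depends only on the starting point and the
backward noise, while the next state is `F x (ξ 0)` with `ξ 0` independent of both. -/
lemma twoSidedLaw_map_pastSeq (hF : Measurable (Function.uncurry F))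
    (hκ : ∀ x, lam.map (F x) = κ x) (hrev : Kernel.IsReversible κ μ) (n : ℤ) :
    (twoSidedLaw lam F μ).map (fun ω => ((fun k : ℕ => ω (n - k)), ω (n + 1))) =
      ((twoSidedLaw lam F μ).map fun ω (k : ℕ) => ω (n - k)) ⊗ₘ
        (κ.comap (fun y : ℕ → ℝ => y 0) (measurable_pi_apply 0)) := by
  have hT := measurable_twoSided hF
  have hpair : ∀ n : ℤ, Measurable fun ω : ℤ → ℝ => ((fun k : ℕ => ω (n - k)), ω (n + 1)) :=
    fun n => (measurable_pastSeq n).prodMk (measurable_pi_apply _)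
  have hshift := twoSidedLaw_map_shift hF hκ hrev n
  have e1 : (twoSidedLaw lam F μ).map (fun ω => ((fun k : ℕ => ω (n - k)), ω (n + 1))) =
      (twoSidedLaw lam F μ).map (fun ω => ((fun k : ℕ => ω (0 - k)), ω (0 + 1))) := by
    conv_rhs => rw [← hshift, Measure.map_map (hpair 0) (measurable_shift n)]
    congr 1
    ext ω k
    · simp only [Function.comp]; congr 1; ring
    · simp only [Function.comp]; congr 1; ring
  have e2 : (twoSidedLaw lam F μ).map (fun ω (k : ℕ) => ω (n - k)) =
      (twoSidedLaw lam F μ).map (fun ω (k : ℕ) => ω (0 - k)) := by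
    conv_rhs => rw [← hshift, Measure.map_map (measurable_pastSeq 0) (measurable_shift n)]
    congr 1
    ext ω k
    simp only [Function.comp]; congr 1; ring
  rw [e1, e2]
  have := isProbabilityMeasure_twoSidedLaw (lam := lam) (μ := μ) hF
  have := Measure.isProbabilityMeasure_map (μ := twoSidedLaw lam F μ)
    (measurable_pastSeq 0).aemeasurable
  refine Measure.ext_of_lintegral _ fun f hf => ?_
  have hfp : Measurable fun ω : ℤ → ℝ => f ((fun k : ℕ => ω (0 - k)), ω (0 + 1)) :=
    hf.comp (hpair 0)
  have hk : Measurable fun y : ℕ → ℝ =>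
      ∫⁻ z, f (y, z) ∂(κ.comap (fun y : ℕ → ℝ => y 0) (measurable_pi_apply 0)) y :=
    hf.lintegral_kernel_prod_right'
  have hkp : Measurable fun ω : ℤ → ℝ =>
      ∫⁻ z, f ((fun k : ℕ => ω (0 - k)), z) ∂κ (ω (0 - (0 : ℕ))) :=
    hk.comp (measurable_pastSeq 0)
  have hfT : Measurable fun q => f ((fun k : ℕ => twoSided F q (0 - k)), twoSided F q (0 + 1)) :=
    hfp.comp hT
  have hkT : Measurable fun q =>
      ∫⁻ z, f ((fun k : ℕ => twoSided F q (0 - k)), z) ∂κ (twoSided F q (0 - (0 : ℕ))) :=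
    hkp.comp hT
  rw [lintegral_map hf (hpair 0), Measure.lintegral_compProd hf,
    lintegral_map hk (measurable_pastSeq 0)]
  simp only [Kernel.comap_apply]
  rw [twoSidedLaw, lintegral_map hfp hT, lintegral_map hkp hT,
    lintegral_prod _ hfT.aemeasurable, lintegral_prod _ hkT.aemeasurable]
  refine lintegral_congr fun x => ?_
  have hm1 : Measurable fun q : (ℕ → E) × (ℕ → E) =>
      f ((fun k : ℕ => twoSided F (x, q) (0 - k)), twoSided F (x, q) (0 + 1)) :=
    hfT.comp measurable_prodMk_left
  have hm2 : Measurable fun q : (ℕ → E) × (ℕ → E) =>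
      ∫⁻ z, f ((fun k : ℕ => twoSided F (x, q) (0 - k)), z) ∂κ (twoSided F (x, q) (0 - (0 : ℕ))) :=
    hkT.comp measurable_prodMk_left
  refine (lintegral_prod_symm _ hm1.aemeasurable).trans
    (Eq.trans ?_ (lintegral_prod_symm _ hm2.aemeasurable).symm)
  refine lintegral_congr fun η => ?_
  simp only [twoSided_nonpos]
  have hm3 : Measurable fun ξ : ℕ → E => f (drivenPath F x η, twoSided F (x, ξ, η) (0 + 1)) := by
    have := hm1.comp (measurable_prodMk_right (y := η))
    simp only [Function.comp_def, twoSided_nonpos] at this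
    exact this
  rw [lintegral_infinitePi_cons lam hm3, lintegral_const, measure_univ, mul_one]
  have e3 : ∀ (e : E) (ξ : ℕ → E), twoSided F (x, consSeq (e, ξ), η) (0 + 1) = F x e :=
    fun e ξ => by
      simp [twoSided, glue, drivenPath, consSeq]
  simp only [e3, lintegral_const, measure_univ, mul_one]
  exact lintegral_kernel_eq hF hκ x (f := fun z => f (drivenPath F x η, z))
    (hf.comp measurable_prodMk_left)

lemma past_le_comap_pastSeq (n : ℤ) :
    past (fun (k : ℤ) (ω : ℤ → ℝ) => ω k) n ≤
      MeasurableSpace.comap (fun (ω : ℤ → ℝ) (k : ℕ) => ω (n - k)) inferInstance := by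
  refine iSup₂_le fun k hk => ?_
  have : (fun ω : ℤ → ℝ => ω k) =
      (fun y : ℕ → ℝ => y (n - k).toNat) ∘ fun (ω : ℤ → ℝ) (k : ℕ) => ω (n - k) := by
    ext ω
    simp only [Function.comp]
    congr 1
    omega
  change MeasurableSpace.comap (fun ω : ℤ → ℝ => ω k) inferInstance ≤ _
  rw [this, ← MeasurableSpace.comap_comp]
  exact MeasurableSpace.comap_mono (measurable_pi_apply _).comap_le

lemma isStationaryMarkovChain_twoSidedLaw (hF : Measurable (Function.uncurry F))
    (hκ : ∀ x, lam.map (F x) = κ x) (hrev : Kernel.IsReversible κ μ) :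
    IsStationaryMarkovChain (twoSidedLaw lam F μ) κ μ fun n ω => ω n := by
  have := isProbabilityMeasure_twoSidedLaw (lam := lam) (μ := μ) hF
  refine ⟨fun n => measurable_pi_apply n, fun n => ?_, fun n B hB => ?_⟩
  · conv_rhs => rw [← twoSidedLaw_map_zero (lam := lam) (μ := μ) hF,
      ← twoSidedLaw_map_shift hF hκ hrev n,
      Measure.map_map (measurable_pi_apply 0) (measurable_shift n)]
    congr 1
    ext ω
    simp only [Function.comp, zero_add]
  · have hle := past_le (W := fun (k : ℤ) (ω : ℤ → ℝ) => ω k) (fun k => measurable_pi_apply k) n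
    have hmB : MeasurableSet ((fun ω : ℤ → ℝ => ω (n + 1)) ⁻¹' B) := measurable_pi_apply _ hB
    have hreal : Measurable fun x => (κ x).real B := (Kernel.measurable_coe κ hB).ennreal_toReal
    symm
    refine ae_eq_condExp_of_forall_setIntegral_eq hle ((integrable_const _).indicator hmB)
      (fun s _ _ => ?_) (fun s hs _ => ?_) ?_
    · refine (integrable_of_norm_le (hreal.comp (measurable_pi_apply n)).aestronglyMeasurable
        (C := 1) fun ω => ?_).integrableOn
      rw [Function.comp, Real.norm_of_nonneg measureReal_nonneg]
      exact measureReal_le_one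
    · obtain ⟨A, hA, rfl⟩ := past_le_comap_pastSeq n s hs
      have hlaw := congrArg (fun ρ => ρ (A ×ˢ B)) (twoSidedLaw_map_pastSeq hF hκ hrev n)
      rw [Measure.map_apply ((measurable_pastSeq n).prodMk (measurable_pi_apply _)) (hA.prod hB),
        Measure.compProd_apply_prod hA hB,
        setLIntegral_map hA (Kernel.measurable_coe _ hB) (measurable_pastSeq n)] at hlaw
      simp only [Kernel.comap_apply, Nat.cast_zero, sub_zero] at hlaw
      rw [setIntegral_indicator hmB, setIntegral_const, smul_eq_mul, mul_one]
      have h2 : Measurable fun ω : ℤ → ℝ => κ (ω n) B :=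
        (Kernel.measurable_coe κ hB).comp (measurable_pi_apply n)
      refine (integral_toReal h2.aemeasurable (ae_of_all _ fun ω => measure_lt_top _ _)).trans ?_
      rw [← hlaw]
      rfl
    · exact (hreal.comp (measurable_past le_rfl)).aestronglyMeasurable

end Path

/-- A reversible Markov kernel admits a two-sided stationary chain. -/
lemma exists_isStationaryMarkovChain {κ : Kernel ℝ ℝ} [IsMarkovKernel κ] {μ : Measure ℝ}
    [IsProbabilityMeasure μ] (hrev : Kernel.IsReversible κ μ) :
    ∃ P : Measure (ℤ → ℝ), IsProbabilityMeasure P ∧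
      IsStationaryMarkovChain P κ μ fun n ω => ω n := by
  -- Every Markov kernel on `ℝ` is the image of uniform noise on the unit interval under a jointly
  -- measurable map, which serves as the recursion.
  obtain ⟨F, hF, hκ⟩ := Kernel.exists_measurable_map_eq_unitInterval κ
  exact ⟨_, isProbabilityMeasure_twoSidedLaw hF, isStationaryMarkovChain_twoSidedLaw hF hκ hrev⟩

end HoldingChain

theorem mainTheorem1 :
    -- `ν` and `π` are probability measures, `Q` is a transition function reversible w.r.t. `π`,
    -- and `g` is bounded with `π`-mean zero
    IsProbabilityMeasure HoldingChain.nu ∧ IsProbabilityMeasure HoldingChain.pi ∧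
    IsMarkovKernel HoldingChain.Q ∧
    Kernel.IsReversible HoldingChain.Q HoldingChain.pi ∧
    MemLp HoldingChain.g ⊤ HoldingChain.pi ∧ ∫ w, HoldingChain.g w ∂HoldingChain.pi = 0 ∧
    -- a two-sided stationary chain with these data exists
    (∃ P : Measure (ℤ → ℝ), IsProbabilityMeasure P ∧
      HoldingChain.IsStationaryMarkovChain P HoldingChain.Q HoldingChain.pi
        (fun n ω => ω n)) ∧
    -- and for every such chain the following holds
    (∀ {Ω : Type*} [MeasurableSpace Ω] (P : Measure Ω) [IsProbabilityMeasure P] (W : ℤ → Ω → ℝ),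
      HoldingChain.IsStationaryMarkovChain P HoldingChain.Q HoldingChain.pi W →
      Asymptotics.IsEquivalent atTop (fun n : ℕ => HoldingChain.sigma P W n ^ 2)
        (fun n : ℕ => 2 * (n : ℝ) * Real.log n) ∧
      Asymptotics.IsEquivalent atTop (HoldingChain.ell P W) (fun n : ℕ => 2 * Real.log n) ∧
      HoldingChain.IsSlowlyVarying (HoldingChain.ell P W) ∧
      HoldingChain.TendstoInCondDistribution P
        (fun n ω => HoldingChain.S W n ω / HoldingChain.sigma P W n) (W 0)
        ⟨gaussianReal 0 (1 / 2), inferInstance⟩ ∧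
      TendstoInDistribution
        (fun (n : ℕ) ω => HoldingChain.S W n ω / HoldingChain.sigma P W n) atTop
        (id : ℝ → ℝ) (fun _ => P) (gaussianReal 0 (1 / 2)) ∧
      Asymptotics.IsEquivalent atTop (fun n : ℕ => ∫ ω, |HoldingChain.S W n ω| ∂P)
        (fun n : ℕ => Real.pi ^ (-(1 / 2) : ℝ) * HoldingChain.sigma P W n) ∧
      TendstoInDistribution
        (fun (n : ℕ) ω => HoldingChain.S W n ω / ∫ ω', |HoldingChain.S W n ω'| ∂P) atTop
        (id : ℝ → ℝ) (fun _ => P) (gaussianReal 0 (Real.toNNReal (Real.pi / 2)))) := by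
  refine ⟨HoldingChain.isProbabilityMeasure_nu, HoldingChain.isProbabilityMeasure_pi,
    HoldingChain.isMarkovKernel_Q, HoldingChain.isReversible_Q, HoldingChain.memLp_g,
    HoldingChain.integral_pi_eq_zero_of_odd HoldingChain.g_neg, ?_,
    fun {Ω} _ P _ W hW => ?_⟩
  · have := HoldingChain.isProbabilityMeasure_pi
    have := HoldingChain.isMarkovKernel_Q
    exact HoldingChain.exists_isStationaryMarkovChain HoldingChain.isReversible_Q
  · have hpi : Real.toNNReal (Real.pi / 2) ≠ 0 := (Real.toNNReal_pos.2 (by positivity)).ne'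
    -- This puts the quotients in the form `r n * S_n` of the general limit theorems.
    simp only [div_eq_inv_mul (HoldingChain.S W _ _)]
    exact ⟨hW.sigma_sq_isEquivalent, hW.ell_isEquivalent, hW.ell_isSlowlyVarying,
      hW.tendstoInCondDistribution HoldingChain.half_ne_zero_nnreal hW.tendsto_sigma_scale,
      hW.tendstoInDistribution HoldingChain.half_ne_zero_nnreal hW.tendsto_sigma_scale,
      hW.integral_abs_isEquivalent, hW.tendstoInDistribution hpi hW.tendsto_abs_scale⟩
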